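/- \textbf{Setting.} Let $U,V,W$ be real random variables and $Z$ a random vector in $\mathbb R^d$; one observes $X=(V,\Delta,Z,W)$ with $\Delta=\mathbf 1_{\{U\le V\}}$. For $x=(v,\delta,z,w)$ and $\psi=(\beta,h,H)$ put $\theta_\psi(x)=\beta'z+h(w)+H(v)$. For a positive integer $\nu$ let $\mathfrak S_{\nu,0}$ be the class of $h:[a,b]\to\mathbb R$ with $h,\dots,h^{(\nu-1)}$ absolutely continuous, $\int_a^b[h^{(\nu)}(w)]^2dw<\infty$ and $E\,h(W)=0$, and let $\mathfrak S_{\nu,0}^{c}=\{h\in\mathfrak S_{\nu,0}:\sup_{[a,b]}|h|<c\}$. Assume: A1. $Z$ takes values in a bounded set; the support of $W$ is $[a,b]$ with $-\infty<a<b<\infty$; the support of $V$ is $[l_v,u_v]$ with $-\infty<l_v<u_v<\infty$. A2. $E\,\mathrm{var}[Z\mid V,W]$ is positive definite. A3. With positive probability, the conditional distribution of $W$ given $V$ dominates the distribution of $W$. A4. $U$ and $V$ are independent given $(Z,W)$. B1. For every $y\in\mathbb R$, $P(U\le y\mid Z,W)=F(\beta_0'Z+h_0(W)+H_0(y))$ almost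 surely. B2. $\beta_0$ belongs to a known bounded open set $B_0\subset\mathbb R^d$. B3. $h_0\in\mathfrak S_{\nu,0}^{c_0}$ for a known $c_0<\infty$. B4. $H_0:\mathbb R\to\mathbb R$ is strictly increasing and bounded on compacts. B5. $F$ is a known distribution function with first and second derivatives $f$ and $\dot f$ on $\mathbb R$; the support of $f$ is $\mathbb R$ and $|\dot f|$ is bounded. For each compact $K\subset\mathbb R$ there are $c\in(0,\infty)$, $\alpha\in(1/2,1]$ and an increasing bijection $\xi:[0,1]\to[0,1]$ with $|F(F^{-1}(u)+s)-F(F^{-1}(v)+s)|\le c\,\epsilon^{\alpha}$ for all $\epsilon\in(0,1)$, $s\in K$ and $u,v\in[0,1]$ with $|\xi(u)-\xi(v)|\le\epsilon$. Moreover $[f^2(v)-\dot f(v)F(v)]\wedge[f^2(v)+\dot f(v)(1-F(v))]>0$ for all $v\in\mathbb R$. With $\psi_0=(\beta_0,h_0,H_0)$ let $$Q_{\psi}(x)=f(\theta_\psi(x))\Big\{\frac{\delta}{F(\theta_\psi(x))}-\frac{1-\delta}{1-F(\theta_\psi(x))}\Big\}.$$ D1. $\tilde h:[a,b]\to\mathbb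 R^d$ has components in $\mathfrak S_{\nu,0}$ and satisfies $$E\Big\{[Z-\tilde h(W)]\Big[h(W)-\frac{E(h(W)Q_{\psi_0}^2(X)\mid V)}{E(Q_{\psi_0}^2(X)\mid V)}\Big]Q_{\psi_0}^2(X)\Big\}=0\quad\text{for every }h\in\mathfrak S_{\nu,0},$$ and (a version of) $$\tilde q(v)=\frac{E(ZQ_{\psi_0}^2(X)\mid V=v)}{E(Q_{\psi_0}^2(X)\mid V=v)}-\frac{E(\tilde h(W)Q_{\psi_0}^2(X)\mid V=v)}{E(Q_{\psi_0}^2(X)\mid V=v)}$$ has a uniformly bounded derivative on $[l_v,u_v]$. D2. $I_0=E(\dot l\,\dot l')$ is positive definite, where $\dot l=\{Z-\tilde h(W)-\tilde q(V)\}Q_{\psi_0}(X)$. Consider the model $\{P_{\beta,h,H}:\beta\in B_0,\ h\in\mathfrak S_{\nu,0}^{c_0},\ H:\mathbb R\to\mathbb R\text{ nondecreasing}\}$ for $X$, in which $(V,Z,W)$ has its true law and $P(\Delta=1\mid V,Z,W)=F(\beta'Z+h(W)+H(V))$. The efficient score for $\beta$ at $\psi_0$ is the score for $\beta$ (the derivative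 in quadratic mean of $\beta\mapsto P_{\beta,h_0,H_0}$ at $\beta_0$) minus its componentwise orthogonal projection in $L_2(P_{\psi_0})$ onto the closed linear span of the scores at $t=0+$ of all paths $t\mapsto P_{\beta_0,h_t,H_t}$ in the model with $(h_t,H_t)=(h_0,H_0)$ at $t=0$ that are differentiable in quadratic mean at $t=0$; the efficient information matrix for $\beta$ is the second moment matrix of the efficient score under $P_{\psi_0}$. \textbf{Theorem.} Under A1--A4, B1--B5 and D1--D2, the law of $X$ is $P_{\psi_0}$, a member of the model; the efficient score for $\beta$ at $\psi_0$ is $(z-\tilde h(w)-\tilde q(v))\,Q_{\psi_0}(x)$; and $I_0=E(\dot l\,\dot l')$ is the efficient information matrix for $\beta$. -/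

import Mathlib

open MeasureTheory ProbabilityTheory Filter Topology Set
open scoped ENNReal

namespace SemiPar

/-! ### Semiparametric models, tangent sets, efficient scores -/

/-- A dominated semiparametric model on the sample space `S` with a parameter of interest
`β ∈ ℝᵈ` and a nuisance parameter in `N`: a dominating measure, the set of admissible parameters,
and the density of each member with respect to the dominating measure. -/
structure Model (S : Type*) [MeasurableSpace S] (d : ℕ) (N : Type*) where
  dom : Measure S
  par : Set (EuclideanSpace ℝ (Fin d) × N)
  dens : EuclideanSpace ℝ (Fin d) → N → S → ℝ

namespace Model

variable {S : Type*} [MeasurableSpace S] {d : ℕ} {N : Type*}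

/-- The law of one observation under the parameter `(β, η)`. -/
noncomputable def law (M : Model S d N) (β : EuclideanSpace ℝ (Fin d)) (η : N) : Measure S :=
  M.dom.withDensity fun x => ENNReal.ofReal (M.dens β η x)

/-- `s = (s₁, …, s_d)`, with `s i ∈ L₂(P₀)`, is the score for `β` at `(β₀, η₀)`: the model
`β ↦ P_{β, η₀}` is differentiable in quadratic mean at `β₀` with derivative `s`. -/
def IsScore (M : Model S d N) (β₀ : EuclideanSpace ℝ (Fin d)) (η₀ : N)
    (s : Fin d → Lp ℝ 2 (M.law β₀ η₀)) : Prop :=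
  Tendsto
    (fun b : EuclideanSpace ℝ (Fin d) =>
      (∫⁻ x, ENNReal.ofReal
        ((Real.sqrt (M.dens (β₀ + b) η₀ x) - Real.sqrt (M.dens β₀ η₀ x)
          - (1 / 2) * (∑ i, b i * s i x) * Real.sqrt (M.dens β₀ η₀ x)) ^ 2) ∂M.dom)
        / ENNReal.ofReal (‖b‖ ^ 2))
    (𝓝[≠] 0) (𝓝 0)

/-- The nuisance tangent set at `(β₀, η₀)`: all scores at `t = 0` of one-dimensional submodels
`t ↦ P_{β₀, η_t}`, `t ≥ 0`, through `η₀` that stay in the parameter set for small `t` and are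
differentiable in quadratic mean at `t = 0`. -/
def nuisanceTangentSet (M : Model S d N) (β₀ : EuclideanSpace ℝ (Fin d)) (η₀ : N) :
    Set (Lp ℝ 2 (M.law β₀ η₀)) :=
  {g | ∃ η : ℝ → N, η 0 = η₀ ∧ (∀ᶠ t in 𝓝[≥] (0 : ℝ), (β₀, η t) ∈ M.par) ∧
    Tendsto
      (fun t : ℝ => ∫⁻ x, ENNReal.ofReal
        (((Real.sqrt (M.dens β₀ (η t) x) - Real.sqrt (M.dens β₀ η₀ x)) / t
          - (1 / 2) * g x * Real.sqrt (M.dens β₀ η₀ x)) ^ 2) ∂M.dom)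
      (𝓝[>] 0) (𝓝 0)}

/-- The closed linear span in `L₂(P₀)` of the nuisance tangent set. -/
noncomputable abbrev nuisanceTangentSpace (M : Model S d N) (β₀ : EuclideanSpace ℝ (Fin d))
    (η₀ : N) : Submodule ℝ (Lp ℝ 2 (M.law β₀ η₀)) :=
  (Submodule.span ℝ (M.nuisanceTangentSet β₀ η₀)).topologicalClosure

/-- `ℓ` is (a version of) the efficient score for `β` at `(β₀, η₀)`: the score for `β` minus its
orthogonal projection, componentwise in `L₂(P₀)`, onto the closed linear span of the nuisance
tangent set. -/
def IsEfficientScore (M : Model S d N) (β₀ : EuclideanSpace ℝ (Fin d)) (η₀ : N)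
    (ℓ : S → EuclideanSpace ℝ (Fin d)) : Prop :=
  ∃ s : Fin d → Lp ℝ 2 (M.law β₀ η₀), M.IsScore β₀ η₀ s ∧
    ∀ i, (fun x => ℓ x i) =ᵐ[M.law β₀ η₀]
      (s i - (M.nuisanceTangentSpace β₀ η₀).starProjection (s i) :
        Lp ℝ 2 (M.law β₀ η₀))

/-- `I` is the efficient information matrix for `β` at `(β₀, η₀)`: the second moment matrix of the
efficient score. -/
def IsEfficientInformation (M : Model S d N) (β₀ : EuclideanSpace ℝ (Fin d)) (η₀ : N)
    (I : Matrix (Fin d) (Fin d) ℝ) : Prop :=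
  ∃ ℓ : S → EuclideanSpace ℝ (Fin d), M.IsEfficientScore β₀ η₀ ℓ ∧
    ∀ i j, I i j = ∫ x, ℓ x i * ℓ x j ∂(M.law β₀ η₀)

end Model

/-! ### Function classes -/

/-- `h` (a function on `[a, b]`; values elsewhere are irrelevant) has `J(h) < ∞`: there are
`h = D₀, D₁, …, D_ν` on `[a, b]`, each the (a.e.) derivative of the absolutely continuous
preceding one, and `D_ν = h^{(ν)}` is square-integrable on `[a, b]`. -/
def MemSobolev (ν : ℕ) (a b : ℝ) (h : ℝ → ℝ) : Prop :=
  ∃ D : ℕ → ℝ → ℝ, (∀ x ∈ Icc a b, D 0 x = h x) ∧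
    (∀ j < ν, IntegrableOn (D (j + 1)) (Icc a b) ∧
      ∀ x ∈ Icc a b, D j x = D j a + ∫ t in a..x, D (j + 1) t) ∧
    MemLp (D ν) 2 (volume.restrict (Icc a b))

/-- The centred class: `J(h) < ∞` and `E h(W) = 0`, where `PW` is the law of `W`. -/
def MemSobolevCentred (ν : ℕ) (a b : ℝ) (PW : Measure ℝ) (h : ℝ → ℝ) : Prop :=
  MemSobolev ν a b h ∧ ∫ w, h w ∂PW = 0

/-- The centred class with `sup_{w ∈ [a, b]} |h(w)| < c`. -/
def MemSobolevCentredBdd (ν : ℕ) (a b : ℝ) (PW : Measure ℝ) (c : ℝ) (h : ℝ → ℝ) : Prop :=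
  MemSobolevCentred ν a b PW h ∧ ∃ c' < c, ∀ w ∈ Icc a b, |h w| ≤ c'

/-! ### The residual error distribution -/

/-- The quantile function `F⁻¹(u)`, used for `0 < u < 1`. -/
noncomputable def quantile (F : ℝ → ℝ) (u : ℝ) : ℝ := sInf {x | u ≤ F x}

/-- `u ↦ F(F⁻¹(u) + s)` on `[0, 1]`, where `F⁻¹(0) = -∞`, `F⁻¹(1) = ∞`, `F(-∞) = 0`,
`F(∞) = 1`. -/
noncomputable def shiftedCdf (F : ℝ → ℝ) (s u : ℝ) : ℝ :=
  if u ≤ 0 then 0 else if 1 ≤ u then 1 else F (quantile F u + s)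

/-- The assumptions on the known residual distribution function `F` with first and second
derivatives `f` and `f'`. -/
structure ErrorDistribution (F f f' : ℝ → ℝ) : Prop where
  mono : Monotone F
  tendsto_atBot : Tendsto F atBot (𝓝 0)
  tendsto_atTop : Tendsto F atTop (𝓝 1)
  hasDerivAt : ∀ x, HasDerivAt F (f x) x
  hasDerivAt_deriv : ∀ x, HasDerivAt f (f' x) x
  support_eq : tsupport f = univ
  bdd_second : ∃ C, ∀ x, |f' x| ≤ C
  holder : ∀ K : Set ℝ, IsCompact K → ∃ c > (0 : ℝ), ∃ α ∈ Ioc (1 / 2 : ℝ) 1,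
    ∃ ξ : Icc (0 : ℝ) 1 ≃o Icc (0 : ℝ) 1, ∀ ε ∈ Ioo (0 : ℝ) 1, ∀ s ∈ K, ∀ u v : Icc (0 : ℝ) 1,
      |(ξ u : ℝ) - (ξ v : ℝ)| ≤ ε → |shiftedCdf F s u - shiftedCdf F s v| ≤ c * ε ^ α
  convexity : ∀ v, 0 < min (f v ^ 2 - f' v * F v) (f v ^ 2 + f' v * (1 - F v))

/-! ### The current status transformation model -/

/-- The sample space of `x = (v, δ, z, w)`. -/
abbrev Obs (d : ℕ) : Type := ℝ × ℝ × EuclideanSpace ℝ (Fin d) × ℝ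

/-- The predictor `θ_ψ(x) = β'z + h(w) + H(v)`, with `ψ = (β, h, H)`. -/
noncomputable def theta {d : ℕ} (β : EuclideanSpace ℝ (Fin d)) (h H : ℝ → ℝ) (x : Obs d) : ℝ :=
  inner ℝ β x.2.2.1 + h x.2.2.2 + H x.1

/-- `Q_ψ(x) = f(θ_ψ(x)) {δ / F(θ_ψ(x)) - (1 - δ) / (1 - F(θ_ψ(x)))}`. -/
noncomputable def Qfun {d : ℕ} (F f : ℝ → ℝ) (β : EuclideanSpace ℝ (Fin d)) (h H : ℝ → ℝ)
    (x : Obs d) : ℝ :=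
  f (theta β h H x) *
    (x.2.1 / F (theta β h H x) - (1 - x.2.1) / (1 - F (theta β h H x)))

/-- The dominating measure for `(v, δ, z, w)`: counting measure on `{0, 1}` for `δ` times the law
`G` of `(V, Z, W)`. -/
noncomputable def domMeasure {d : ℕ} (G : Measure (ℝ × EuclideanSpace ℝ (Fin d) × ℝ)) :
    Measure (Obs d) :=
  ((Measure.dirac (0 : ℝ) + Measure.dirac 1).prod G).map
    fun y : ℝ × ℝ × EuclideanSpace ℝ (Fin d) × ℝ => (y.2.1, y.1, y.2.2.1, y.2.2.2)

/-- The partly linear transformation model for current status data with covariate and censoring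
law `G`. The parameters are `β` in `B₀`, `h` in the centred class bounded by `c₀`, and `H`
nondecreasing; given `(V, Z, W) = (v, z, w)`, `Δ` is Bernoulli with parameter
`F (β'z + h(w) + H(v))`. -/
noncomputable def transformationModel {d : ℕ} (F : ℝ → ℝ)
    (G : Measure (ℝ × EuclideanSpace ℝ (Fin d) × ℝ)) (B₀ : Set (EuclideanSpace ℝ (Fin d)))
    (ν : ℕ) (a b c₀ : ℝ) : Model (Obs d) d ((ℝ → ℝ) × (ℝ → ℝ)) where
  dom := domMeasure G
  par := {p | p.1 ∈ B₀ ∧ MemSobolevCentredBdd ν a b (G.map fun y => y.2.2) c₀ p.2.1 ∧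
    Monotone p.2.2}
  dens := fun β η x =>
    x.2.1 * F (theta β η.1 η.2 x) + (1 - x.2.1) * (1 - F (theta β η.1 η.2 x))

section Data

variable {Ω : Type*} [MeasurableSpace Ω] {d : ℕ}

/-- The `σ`-algebra generated by `Y`. -/
abbrev sig {α : Type*} [MeasurableSpace α] (Y : Ω → α) : MeasurableSpace Ω :=
  MeasurableSpace.comap Y inferInstance

/-- The observation `X = (V, Δ, Z, W)` with `Δ = 1_{U ≤ V}`. -/
noncomputable def obs (U V : Ω → ℝ) (Z : Ω → EuclideanSpace ℝ (Fin d)) (W : Ω → ℝ) (ω : Ω) :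
    Obs d :=
  (V ω, {ω' | U ω' ≤ V ω'}.indicator (fun _ => (1 : ℝ)) ω, Z ω, W ω)

/-- The matrix `E var[Z | V, W]`. -/
noncomputable def expectedCondVar (μ : Measure Ω) (V : Ω → ℝ)
    (Z : Ω → EuclideanSpace ℝ (Fin d)) (W : Ω → ℝ) : Matrix (Fin d) (Fin d) ℝ :=
  Matrix.of fun i j => ∫ ω,
    (μ[fun ω' =>
        (Z ω' i - (μ[fun ω'' => Z ω'' i | sig fun ω'' => (V ω'', W ω'')]) ω') *
        (Z ω' j - (μ[fun ω'' => Z ω'' j | sig fun ω'' => (V ω'', W ω'')]) ω') |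
      sig fun ω' => (V ω', W ω')]) ω ∂μ

/-- `U` and `V` are conditionally independent given `Y`. -/
def CondIndepGiven {α : Type*} [MeasurableSpace α] (μ : Measure Ω) (U V : Ω → ℝ)
    (Y : Ω → α) : Prop :=
  ∀ s t : Set ℝ, MeasurableSet s → MeasurableSet t →
    (μ[(U ⁻¹' s ∩ V ⁻¹' t).indicator fun _ => (1 : ℝ) | sig Y]) =ᵐ[μ]
      (μ[(U ⁻¹' s).indicator fun _ => (1 : ℝ) | sig Y]) *
        (μ[(V ⁻¹' t).indicator fun _ => (1 : ℝ) | sig Y])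

/-- The distributional assumptions on `(U, V, Z, W)` at the true parameter `(β₀, h₀, H₀)`. -/
structure DataAssumptions (μ : Measure Ω) [IsFiniteMeasure μ] (U V : Ω → ℝ) (Z : Ω → EuclideanSpace ℝ (Fin d))
    (W : Ω → ℝ) (a b l u : ℝ) (F : ℝ → ℝ) (β₀ : EuclideanSpace ℝ (Fin d))
    (h₀ H₀ : ℝ → ℝ) : Prop where
  /-- `Z` takes values in a bounded set. -/
  bdd_Z : ∃ C, ∀ᵐ ω ∂μ, ‖Z ω‖ ≤ C
  /-- The support of `W` is `[a, b]`. -/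
  a_lt_b : a < b
  support_W : (μ.map W).support = Icc a b
  /-- The support of `V` is `[l, u]`. -/
  l_lt_u : l < u
  support_V : (μ.map V).support = Icc l u
  /-- `E var[Z | V, W]` is positive definite. -/
  condVar_posDef : (expectedCondVar μ V Z W).PosDef
  /-- With positive probability, the conditional law of `W` given `V` dominates the law of `W`. -/
  dominates : 0 < μ {ω | μ.map W ≪ condDistrib W V μ (V ω)}
  /-- `U` and `V` are independent given `(Z, W)`. -/
  condIndep : CondIndepGiven μ U V fun ω => (Z ω, W ω)
  /-- The transformation model: `P(U ≤ y | Z, W) = F(β₀'Z + h₀(W) + H₀(y))` for every `y`. -/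
  transformation : ∀ y : ℝ,
    (μ[(U ⁻¹' Iic y).indicator fun _ => (1 : ℝ) | sig fun ω => (Z ω, W ω)]) =ᵐ[μ]
      fun ω => F (inner ℝ β₀ (Z ω) + h₀ (W ω) + H₀ y)

/-- `E[g Q² | V] / E[Q² | V]`, where `Q` is `Q_{ψ₀}(X)`. -/
noncomputable def weightedCondExp (μ : Measure Ω) (V : Ω → ℝ) (Q g : Ω → ℝ) : Ω → ℝ :=
  fun ω => (μ[fun ω' => g ω' * Q ω' ^ 2 | sig V]) ω / (μ[fun ω' => Q ω' ^ 2 | sig V]) ω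

/-- `h̃` and `q̃` are the (vector-valued) least favourable directions for `h` and `H`: the components
of `h̃` are in the centred class, the orthogonality relation
`E{[Z - h̃(W)] [h(W) - E(h(W) Q² | V) / E(Q² | V)] Q²} = 0` holds for every `h` in the centred
class, and `q̃` is a version of
`E(Z Q² | V = v) / E(Q² | V = v) - E(h̃(W) Q² | V = v) / E(Q² | V = v)` that has a
uniformly bounded derivative on `[l, u]`. -/
structure IsLeastFavourable (μ : Measure Ω) (V : Ω → ℝ) (Z : Ω → EuclideanSpace ℝ (Fin d))
    (W : Ω → ℝ) (ν : ℕ) (a b l u : ℝ) (Q : Ω → ℝ)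
    (ht qt : ℝ → EuclideanSpace ℝ (Fin d)) : Prop where
  mem : ∀ i, MemSobolevCentred ν a b (μ.map W) fun w => ht w i
  orthogonal : ∀ h : ℝ → ℝ, MemSobolevCentred ν a b (μ.map W) h → ∀ i,
    ∫ ω, (Z ω i - ht (W ω) i) *
      (h (W ω) - weightedCondExp μ V Q (fun ω' => h (W ω')) ω) * Q ω ^ 2 ∂μ = 0
  version : ∀ i, (fun ω => qt (V ω) i) =ᵐ[μ] fun ω =>
    weightedCondExp μ V Q (fun ω' => Z ω' i) ω -
      weightedCondExp μ V Q (fun ω' => ht (W ω') i) ω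
  differentiable : DifferentiableOn ℝ qt (Icc l u)
  bdd_deriv : ∃ C, ∀ v ∈ Icc l u, ‖derivWithin qt (Icc l u) v‖ ≤ C

end Data

/-- The function `x ↦ (z - h̃(w) - q̃(v)) Q_{ψ₀}(x)`. -/
noncomputable def ldot {d : ℕ} (F f : ℝ → ℝ) (β₀ : EuclideanSpace ℝ (Fin d)) (h₀ H₀ : ℝ → ℝ)
    (ht qt : ℝ → EuclideanSpace ℝ (Fin d)) (x : Obs d) : EuclideanSpace ℝ (Fin d) :=
  Qfun F f β₀ h₀ H₀ x • (x.2.2.1 - ht x.2.2.2 - qt x.1)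

/-- The second moment matrix `E(Y Y')`. -/
noncomputable def secondMoment {Ω : Type*} [MeasurableSpace Ω] {d : ℕ} (μ : Measure Ω)
    (Y : Ω → EuclideanSpace ℝ (Fin d)) : Matrix (Fin d) (Fin d) ℝ :=
  Matrix.of fun i j => ∫ ω, Y ω i * Y ω j ∂μ

end SemiPar

/-! The law of `X` is a statement about the conditional probability of `U ≤ V`. Conditional
independence lets a constant threshold `y` be handled on events of `(V, Z, W)`, and the random
threshold `V` is approximated from above by countably valued ones. The limit needs `H₀` right
continuous, which the model forces: `y ↦ P(U ≤ y)` is right continuous and `F` is strictly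
increasing, so a right jump of `H₀` is impossible (`rightContinuous_of_condExp`,
`setIntegral_current_status`, `map_obs_eq_withDensity`).

For the efficient score, `θ` is bounded on the range of the data, so a uniform quadratic expansion
of `√F` and `√(1 - F)` gives differentiability in quadratic mean. The score for `β` is `z Q`, and
the linear path `(h₀ + t k, H₀ + t r)`, with `k` centred and `r` nondecreasing, has score `(k(w) +
r(v)) Q`. Since `q̃` is Lipschitz on `[l, u]`, each component is there a difference of nondecreasing
functions; hence `(h̃(w) + q̃(v)) Q` lies in the linear span of the nuisance scores. It remains to
show that the residual `(z - h̃(w) - q̃(v)) Q` is orthogonal to every nuisance score.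

The defining relations of `h̃` and `q̃` are weighted normal equations. They make the residual
orthogonal to `k(w) Q` and `r(v) Q` for all centred `k` and monotone `r`
(`weighted_residual_orthogonal`, `integral_ldot_mul_eq_zero`).

The main difficulty is that the tangent set admits arbitrary differentiable paths, whose scores have
no prescribed form. Write `D_t = √p_t - √p_0`. For the increment `η_t` of the predictor, `D_t`
equals `η_t Q √p_0 / 2` up to a remainder `O(D_t²)`. This error is quadratic in `D_t` itself, so
after division by `t` it is `O(t (D_t / t)²)` and vanishes in `L₁`, because `D_t / t` converges in
`L₂`. No convergence of `η_t / t` is needed. The linear part is a centred function of `w` plus a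
difference of monotone functions of `v`, times `Q √p_0`, hence orthogonal to the residual for each
`t`; so is the limit. As `H_t` need not be uniformly bounded, it is first truncated. Truncation
preserves monotonicity, and where it acts `|D_t|` is bounded below, so that the error there is again
`O(D_t²)` (`exists_truncated_le`, `integral_mul_eq_zero_of_quadratic_remainder`,
`integral_mul_nuisance_score_eq_zero`). -/

namespace SemiPar

/-! ### Quadratic expansion of root densities -/

/-- A second order Taylor bound on a compact interval. -/
theorem abs_taylor_le {φ φ₁ φ₂ : ℝ → ℝ} (h₁ : ∀ x, HasDerivAt φ (φ₁ x) x)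
    (h₂ : ∀ x, HasDerivAt φ₁ (φ₂ x) x) {r L : ℝ} (hL : ∀ x ∈ Icc (-r) r, |φ₂ x| ≤ L)
    {x η : ℝ} (hx : x ∈ Icc (-r) r) (hxη : x + η ∈ Icc (-r) r) :
    |φ (x + η) - φ x - φ₁ x * η| ≤ L * η ^ 2 := by
  have hsub : uIcc x (x + η) ⊆ Icc (-r) r := (convex_Icc _ _).ordConnected.uIcc_subset hx hxη
  have hdist : ∀ y ∈ uIcc x (x + η), |y - x| ≤ |η| := fun y hy => by
    simpa using abs_sub_left_of_mem_uIcc hy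
  have hL0 : 0 ≤ L := (abs_nonneg _).trans (hL x hx)
  have step : ∀ y ∈ uIcc x (x + η), |φ₁ y - φ₁ x| ≤ L * |η| := fun y hy => by
    have := Convex.norm_image_sub_le_of_norm_hasDerivWithin_le (f := φ₁) (f' := φ₂) (C := L)
      (s := Icc (-r) r) (fun z _ => (h₂ z).hasDerivWithinAt) hL (convex_Icc _ _) hx (hsub hy)
    exact this.trans (mul_le_mul_of_nonneg_left (hdist y hy) hL0)
  have := Convex.norm_image_sub_le_of_norm_hasDerivWithin_le
    (f := fun y => φ y - φ₁ x * y) (f' := fun y => φ₁ y - φ₁ x) (C := L * |η|)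
    (s := uIcc x (x + η)) (x := x) (y := x + η)
    (fun z _ => ((h₁ z).fun_sub (by
      simpa using (hasDerivAt_id' z).const_mul (φ₁ x))).hasDerivWithinAt)
    step (convex_uIcc _ _) left_mem_uIcc right_mem_uIcc
  simp only [Real.norm_eq_abs, add_sub_cancel_left] at this
  calc |φ (x + η) - φ x - φ₁ x * η| = |φ (x + η) - φ₁ x * (x + η) - (φ x - φ₁ x * x)| := by
        congr 1; ring
    _ ≤ L * |η| * |η| := this
    _ = L * η ^ 2 := by rw [mul_assoc, ← sq, sq_abs]

/-- A quadratic expansion of `√G`, uniformly on compacts, for a positive function `G` with bounded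
second derivative. -/
theorem exists_sqrt_taylor_le {G g g' : ℝ → ℝ} (hG : ∀ x, 0 < G x)
    (h₁ : ∀ x, HasDerivAt G (g x) x) (h₂ : ∀ x, HasDerivAt g (g' x) x) {B : ℝ}
    (hB : ∀ x, |g' x| ≤ B) (R K : ℝ) :
    ∃ C, 0 ≤ C ∧ ∀ θ η, |θ| ≤ R → |η| ≤ K →
      |√(G (θ + η)) - √(G θ) - g θ / (2 * √(G θ)) * η| ≤ C * η ^ 2 := by
  have hs : ∀ x, 0 < √(G x) := fun x => Real.sqrt_pos.2 (hG x)
  have d₁ : ∀ x, HasDerivAt (fun y => √(G y)) (g x / (2 * √(G x))) x :=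
    fun x => (h₁ x).sqrt (hG x).ne'
  have d₂ : ∀ x, HasDerivAt (fun y => g y / (2 * √(G y)))
      ((g' x * (2 * √(G x)) - g x * (2 * (g x / (2 * √(G x))))) / (2 * √(G x)) ^ 2) x :=
    fun x => (h₂ x).div ((d₁ x).const_mul 2) (by have := hs x; positivity)
  have hGc : Continuous fun y => √(G y) :=
    continuous_iff_continuousAt.2 fun x => (d₁ x).continuousAt
  have hgc : Continuous g := continuous_iff_continuousAt.2 fun x => (h₂ x).continuousAt
  -- `g'` is bounded but need not be continuous, so the second derivative of `√G` is dominated by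
  -- this continuous function, with `B` in place of `|g'|`, before compactness is used.
  have hBc : Continuous fun x => (B * (2 * √(G x)) + |g x| * (2 * (|g x| / (2 * √(G x)))))
      / (2 * √(G x)) ^ 2 := by
    refine Continuous.div (by
      refine (continuous_const.mul (continuous_const.mul hGc)).add (hgc.abs.mul
        (continuous_const.mul (hgc.abs.div (continuous_const.mul hGc) ?_)))
      intro x; have := hs x; positivity) (by fun_prop) ?_
    intro x; have := hs x; positivity
  obtain ⟨C, hC⟩ := (isCompact_Icc (a := -(R + K)) (b := R + K)).exists_bound_of_continuousOn
    hBc.continuousOn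
  refine ⟨max C 0, le_max_right _ _, fun θ η hθ hη => ?_⟩
  have hK : 0 ≤ K := (abs_nonneg _).trans hη
  have hR : 0 ≤ R := (abs_nonneg _).trans hθ
  rw [abs_le] at hθ hη
  refine abs_taylor_le d₁ d₂ (r := R + K) (fun x hx => ?_) ⟨by linarith, by linarith⟩
    ⟨by linarith, by linarith⟩
  refine le_trans ?_ ((le_abs_self _).trans ((hC x hx).trans (le_max_left _ _)))
  have := hs x
  rw [abs_div, abs_of_pos (a := (2 * √(G x)) ^ 2) (by positivity)]
  gcongr
  refine (abs_sub _ _).trans ?_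
  rw [abs_mul, abs_mul (g x), abs_mul 2 (g x / _), abs_div, abs_of_pos (a := 2 * √(G x))
    (by positivity), abs_of_pos (a := (2 : ℝ)) (by positivity)]
  gcongr
  exact hB x

/-- The density of `Δ ∈ {0, 1}` with success probability `F θ`. -/
noncomputable def bernoulliDens (F : ℝ → ℝ) (δ θ : ℝ) : ℝ := δ * F θ + (1 - δ) * (1 - F θ)

/-- The derivative of the log-density `log (bernoulliDens F δ θ)` in `θ`. -/
noncomputable def bernoulliScore (F f : ℝ → ℝ) (δ θ : ℝ) : ℝ :=
  f θ * (δ / F θ - (1 - δ) / (1 - F θ))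

/-! ### Consequences of the assumptions on the residual distribution -/

namespace ErrorDistribution

variable {F f f' : ℝ → ℝ} (hF : ErrorDistribution F f f')

include hF

theorem continuous : Continuous F :=
  continuous_iff_continuousAt.2 fun x => (hF.hasDerivAt x).continuousAt

theorem continuous_deriv : Continuous f :=
  continuous_iff_continuousAt.2 fun x => (hF.hasDerivAt_deriv x).continuousAt

theorem nonneg (x : ℝ) : 0 ≤ F x := hF.mono.le_of_tendsto hF.tendsto_atBot x

theorem le_one (x : ℝ) : F x ≤ 1 := hF.mono.ge_of_tendsto hF.tendsto_atTop x

/-- At a zero of `f`, `convexity` would require both `-f' x * F x > 0` and `f' x * (1 - F x) > 0`,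
that is, opposite signs of `f' x`. The support condition alone would allow isolated zeros. -/
theorem deriv_pos (x : ℝ) : 0 < f x := by
  have h0 : 0 ≤ f x := by
    rw [← (hF.hasDerivAt x).deriv]; exact hF.mono.deriv_nonneg
  refine h0.lt_of_ne fun h => ?_
  have hc := hF.convexity x
  rw [← h, lt_min_iff] at hc
  have h1 := hF.nonneg x
  have h2 := hF.le_one x
  rcases le_total 0 (f' x) with h3 | h3
  · nlinarith [mul_nonneg h3 h1]
  · nlinarith [mul_nonneg (neg_nonneg.2 h3) (sub_nonneg.2 h2)]

theorem strictMono : StrictMono F :=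
  strictMono_of_deriv_pos fun x => by rw [(hF.hasDerivAt x).deriv]; exact hF.deriv_pos x

theorem pos (x : ℝ) : 0 < F x := (hF.nonneg (x - 1)).trans_lt (hF.strictMono (by linarith))

theorem lt_one (x : ℝ) : F x < 1 := (hF.strictMono (by linarith)).trans_le (hF.le_one (x + 1))

theorem bernoulliDens_pos {δ : ℝ} (hδ : δ = 0 ∨ δ = 1) (θ : ℝ) : 0 < bernoulliDens F δ θ := by
  rcases hδ with rfl | rfl
  · simpa [bernoulliDens] using hF.lt_one θ
  · simpa [bernoulliDens] using hF.pos θ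

theorem bernoulliDens_le_one {δ : ℝ} (hδ : δ = 0 ∨ δ = 1) (θ : ℝ) :
    bernoulliDens F δ θ ≤ 1 := by
  rcases hδ with rfl | rfl
  · simpa [bernoulliDens] using hF.nonneg θ
  · simpa [bernoulliDens] using hF.le_one θ

/-- The derivative of `√p` is `(p' / p) √p / 2`; for the Bernoulli density `p' / p` is the score.
The two values of `δ` are the expansions of `√(1 - F)` and `√F`. -/
theorem exists_taylor_le (R K : ℝ) :
    ∃ C, 0 ≤ C ∧ ∀ δ θ η, δ = 0 ∨ δ = 1 → |θ| ≤ R → |η| ≤ K →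
      |√(bernoulliDens F δ (θ + η)) - √(bernoulliDens F δ θ)
        - 1 / 2 * (η * bernoulliScore F f δ θ) * √(bernoulliDens F δ θ)| ≤ C * η ^ 2 := by
  obtain ⟨B, hB⟩ := hF.bdd_second
  obtain ⟨C₁, h₁, hC₁⟩ := exists_sqrt_taylor_le hF.pos hF.hasDerivAt hF.hasDerivAt_deriv hB R K
  obtain ⟨C₀, h₀, hC₀⟩ := exists_sqrt_taylor_le (G := fun x => 1 - F x) (g := fun x => -f x)
    (g' := fun x => -f' x) (fun x => by linarith [hF.lt_one x])
    (fun x => by simpa using (hF.hasDerivAt x).const_sub 1)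
    (fun x => (hF.hasDerivAt_deriv x).neg) (by simpa using hB) R K
  refine ⟨max C₀ C₁, h₀.trans (le_max_left _ _), fun δ θ η hδ hθ hη => ?_⟩
  rcases hδ with rfl | rfl
  · refine le_trans (le_of_eq ?_) ((hC₀ θ η hθ hη).trans (by gcongr; exact le_max_left _ _))
    have hp : 0 < 1 - F θ := by linarith [hF.lt_one θ]
    have hs := Real.sqrt_pos.2 hp
    have hsq := Real.sq_sqrt hp.le
    simp only [bernoulliDens, bernoulliScore, zero_mul, zero_add, sub_zero, one_mul, zero_div,
      zero_sub]
    congr 2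
    field_simp
    rw [hsq]
  · refine le_trans (le_of_eq ?_) ((hC₁ θ η hθ hη).trans (by gcongr; exact le_max_right _ _))
    have hp : 0 < F θ := hF.pos θ
    have hs := Real.sqrt_pos.2 hp
    have hsq := Real.sq_sqrt hp.le
    simp only [bernoulliDens, bernoulliScore, sub_self, zero_mul, add_zero, one_mul, zero_div,
      sub_zero]
    congr 2
    field_simp
    rw [hsq]

/-- By continuity `f` has a positive minimum on a unit neighbourhood of the compact interval, which
settles `|η| ≤ 1` by the mean value theorem. For larger `|η|`, monotonicity of `F` preserves the
gain already made at distance one. -/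
theorem exists_le_abs_sub (R : ℝ) :
    ∃ m, 0 < m ∧ ∀ θ η, |θ| ≤ R → m * min |η| 1 ≤ |F (θ + η) - F θ| := by
  obtain ⟨m, hm, hfm⟩ : ∃ m, 0 < m ∧ ∀ x ∈ Icc (-(|R| + 1)) (|R| + 1), m ≤ f x := by
    obtain ⟨x, -, hx⟩ := (isCompact_Icc (a := -(|R| + 1)) (b := |R| + 1)).exists_isMinOn
      ⟨0, by constructor <;> linarith [abs_nonneg R]⟩ hF.continuous_deriv.continuousOn
    exact ⟨f x, hF.deriv_pos x, fun y hy => hx hy⟩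
  have key : ∀ x y, x ≤ y → x ∈ Icc (-(|R| + 1)) (|R| + 1) → y ∈ Icc (-(|R| + 1)) (|R| + 1) →
      m * (y - x) ≤ F y - F x := fun x y hxy hx hy => by
    rcases hxy.eq_or_lt with rfl | hxy
    · simp
    obtain ⟨c, hc, h⟩ := exists_hasDerivAt_eq_slope F f hxy hF.continuous.continuousOn
      fun z _ => hF.hasDerivAt z
    rw [eq_div_iff (by linarith)] at h
    rw [← h]
    exact mul_le_mul_of_nonneg_right (hfm c ⟨hx.1.trans hc.1.le, hc.2.le.trans hy.2⟩)
      (by linarith)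
  refine ⟨m, hm, fun θ η hθ => ?_⟩
  have hθ' := abs_le.1 (hθ.trans (le_abs_self R))
  rcases le_total 0 η with h | h
  · have h1 : min η 1 ≤ 1 := min_le_right _ _
    have h2 : 0 ≤ min η 1 := le_min h zero_le_one
    have := key θ (θ + min η 1) (by linarith) ⟨by linarith, by linarith⟩
      ⟨by linarith, by linarith⟩
    have h3 : F (θ + min η 1) ≤ F (θ + η) := hF.mono (by linarith [min_le_left η 1])
    rw [abs_of_nonneg h]
    refine le_trans ?_ (le_abs_self _)
    rw [add_sub_cancel_left] at this
    linarith
  · have h0 : 0 ≤ -η := by linarith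
    have h1 : min (-η) 1 ≤ 1 := min_le_right _ _
    have h2 : 0 ≤ min (-η) 1 := le_min h0 zero_le_one
    have := key (θ - min (-η) 1) θ (by linarith) ⟨by linarith, by linarith⟩
      ⟨by linarith, by linarith⟩
    have h3 : F (θ + η) ≤ F (θ - min (-η) 1) := hF.mono (by linarith [min_le_left (-η) 1])
    rw [abs_of_nonpos h]
    refine le_trans ?_ (neg_le_abs _)
    rw [sub_sub_cancel] at this
    linarith

/-- The increment of the root density controls the truncated increment of the predictor to second
order. -/
theorem exists_truncated_le (R K : ℝ) :
    ∃ C, 0 ≤ C ∧ ∀ δ θ η η', δ = 0 ∨ δ = 1 → |θ| ≤ R → |η'| ≤ K → (η = η' ∨ 1 ≤ |η|) →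
      |√(bernoulliDens F δ (θ + η)) - √(bernoulliDens F δ θ)
        - 1 / 2 * (η' * bernoulliScore F f δ θ) * √(bernoulliDens F δ θ)|
      ≤ C * (√(bernoulliDens F δ (θ + η)) - √(bernoulliDens F δ θ)) ^ 2 := by
  obtain ⟨C, hC0, hC⟩ := hF.exists_taylor_le R (|K| + 1)
  obtain ⟨m, hm, hFm⟩ := hF.exists_le_abs_sub R
  -- The increment of `F` is, up to sign, `(√x - √y) (√x + √y)`, and the second factor is at most
  -- `2`.
  have lower : ∀ δ θ η, δ = 0 ∨ δ = 1 → |θ| ≤ R → m / 2 * min |η| 1 ≤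
      |√(bernoulliDens F δ (θ + η)) - √(bernoulliDens F δ θ)| := fun δ θ η hδ hθ => by
    have h1 := hFm θ η hθ
    have e : |F (θ + η) - F θ| = |bernoulliDens F δ (θ + η) - bernoulliDens F δ θ| := by
      rcases hδ with rfl | rfl
      · simp only [bernoulliDens]; rw [abs_sub_comm]; congr 1; ring
      · simp only [bernoulliDens]; congr 1; ring
    have p1 := hF.bernoulliDens_pos hδ (θ + η)
    have p0 := hF.bernoulliDens_pos hδ θ
    have q1 := hF.bernoulliDens_le_one hδ (θ + η)
    have q0 := hF.bernoulliDens_le_one hδ θ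
    rw [e] at h1
    set x := bernoulliDens F δ (θ + η)
    set y := bernoulliDens F δ θ
    have : x - y = (√x - √y) * (√x + √y) := by
      rw [mul_comm, ← sq_sub_sq, Real.sq_sqrt p1.le, Real.sq_sqrt p0.le]
    rw [this, abs_mul, abs_of_nonneg (a := √x + √y) (by positivity)] at h1
    have h2 : √x + √y ≤ 2 := by
      have := Real.sqrt_le_one.2 q1
      have := Real.sqrt_le_one.2 q0
      linarith
    nlinarith [abs_nonneg (√x - √y), mul_le_mul_of_nonneg_left h2 (abs_nonneg (√x - √y))]
  -- A bound of at least `1` is needed for `|η| ≤ K' * min |η| 1`.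
  set K' := |K| + 1 with hK'
  have hK'1 : 1 ≤ K' := by linarith [abs_nonneg K]
  -- the remainder for the truncated increment
  have hbig : ∀ δ θ η', δ = 0 ∨ δ = 1 → |θ| ≤ R → |η'| ≤ K' →
      |1 / 2 * (η' * bernoulliScore F f δ θ) * √(bernoulliDens F δ θ)| ≤ 2 + C * K' ^ 2 := by
    intro δ θ η' hδ hθ hη'
    have h := hC δ θ η' hδ hθ hη'
    have b1 := Real.sqrt_le_one.2 (hF.bernoulliDens_le_one hδ (θ + η'))
    have b0 := Real.sqrt_le_one.2 (hF.bernoulliDens_le_one hδ θ)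
    have c1 := Real.sqrt_nonneg (bernoulliDens F δ (θ + η'))
    have c0 := Real.sqrt_nonneg (bernoulliDens F δ θ)
    have e : η' ^ 2 ≤ K' ^ 2 := sq_le_sq' (by linarith [(abs_le.1 hη').1]) (abs_le.1 hη').2
    have e' := mul_le_mul_of_nonneg_left e hC0
    rw [abs_le] at h ⊢
    constructor <;> linarith [h.1, h.2]
  -- First constant: without truncation, `|η| ≤ (2 K' / m) |D|` turns the Taylor bound into one in
  -- `D²`. Second constant: if `|η| ≥ 1` then `|D| ≥ m / 2`, so the crude bound `4 + C K'²` on the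
  -- remainder is absorbed by `(2 / m)² D² ≥ 1`.
  refine ⟨max (C * (2 * K' / m) ^ 2) ((4 + C * K' ^ 2) * (2 / m) ^ 2), by positivity,
    fun δ θ η η' hδ hθ hη' h => ?_⟩
  have hη'K : |η'| ≤ K' := by linarith [le_abs_self K]
  have hl := lower δ θ η hδ hθ
  set D := √(bernoulliDens F δ (θ + η)) - √(bernoulliDens F δ θ) with hD
  rcases h with rfl | h
  · refine (hC δ θ η hδ hθ hη'K).trans ?_
    have h1 : |η| ≤ K' * min |η| 1 := by
      rcases le_total |η| 1 with h | h
      · rw [min_eq_left h]; nlinarith [abs_nonneg η]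
      · rw [min_eq_right h]; linarith
    have h2 : |η| ≤ 2 * K' / m * |D| := by
      rw [div_mul_eq_mul_div, le_div_iff₀ hm]
      nlinarith [mul_le_mul_of_nonneg_left hl (by positivity : (0:ℝ) ≤ 2 * K'),
        mul_le_mul_of_nonneg_right h1 hm.le]
    have h3 : η ^ 2 ≤ (2 * K' / m) ^ 2 * D ^ 2 := by
      rw [← sq_abs η, ← sq_abs D, ← mul_pow]
      exact pow_le_pow_left₀ (abs_nonneg _) h2 2
    calc C * η ^ 2 ≤ C * ((2 * K' / m) ^ 2 * D ^ 2) := by gcongr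
      _ = C * (2 * K' / m) ^ 2 * D ^ 2 := by ring
      _ ≤ _ := by gcongr; exact le_max_left _ _
  · rw [min_eq_right h, mul_one] at hl
    have h1 : 1 ≤ 2 / m * |D| := by
      rw [div_mul_eq_mul_div, le_div_iff₀ hm]; linarith
    have h3 : 1 ≤ (2 / m) ^ 2 * D ^ 2 := by
      rw [← sq_abs D, ← mul_pow]
      exact one_le_pow₀ h1
    have hDb : |D| ≤ 2 := by
      have b1 := Real.sqrt_le_one.2 (hF.bernoulliDens_le_one hδ (θ + η))
      have b0 := Real.sqrt_le_one.2 (hF.bernoulliDens_le_one hδ θ)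
      have c1 := Real.sqrt_nonneg (bernoulliDens F δ (θ + η))
      have c0 := Real.sqrt_nonneg (bernoulliDens F δ θ)
      rw [abs_le]; constructor <;> linarith
    calc |D - 1 / 2 * (η' * bernoulliScore F f δ θ) * √(bernoulliDens F δ θ)|
        ≤ |D| + |1 / 2 * (η' * bernoulliScore F f δ θ) * √(bernoulliDens F δ θ)| := abs_sub _ _
      _ ≤ 4 + C * K' ^ 2 := by linarith [hbig δ θ η' hδ hθ hη'K]
      _ ≤ (4 + C * K' ^ 2) * ((2 / m) ^ 2 * D ^ 2) := le_mul_of_one_le_right (by positivity) h3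
      _ = (4 + C * K' ^ 2) * (2 / m) ^ 2 * D ^ 2 := by ring
      _ ≤ _ := by gcongr; exact le_max_right _ _

/-- The score of `Δ` and its inverse are bounded on compacts. -/
theorem exists_score_bounds (R : ℝ) :
    ∃ c C, 0 < c ∧ ∀ δ θ, δ = 0 ∨ δ = 1 → |θ| ≤ R →
      c ≤ bernoulliScore F f δ θ ^ 2 ∧ |bernoulliScore F f δ θ| ≤ C := by
  have key : ∀ S : ℝ → ℝ, Continuous S → (∀ x, S x ≠ 0) → ∃ c C, 0 < c ∧ ∀ θ, |θ| ≤ R →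
      c ≤ S θ ^ 2 ∧ |S θ| ≤ C := fun S hS hne => by
    obtain ⟨C, hC⟩ := (isCompact_Icc (a := -|R|) (b := |R|)).exists_bound_of_continuousOn
      hS.continuousOn
    obtain ⟨x, -, hx⟩ := (isCompact_Icc (a := -|R|) (b := |R|)).exists_isMinOn
      ⟨0, by constructor <;> linarith [abs_nonneg R]⟩ (hS.pow 2).continuousOn
    refine ⟨S x ^ 2, C, by have := hne x; positivity, fun θ hθ => ?_⟩
    have : θ ∈ Icc (-|R|) |R| := abs_le.1 (hθ.trans (le_abs_self R))
    exact ⟨hx this, hC θ this⟩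
  obtain ⟨c₁, C₁, hc₁, h₁⟩ := key (bernoulliScore F f 1) (by
      unfold bernoulliScore
      refine hF.continuous_deriv.mul ((continuous_const.div hF.continuous fun x =>
        (hF.pos x).ne').sub (continuous_const.div (continuous_const.sub hF.continuous) fun x => by
          linarith [hF.lt_one x]))) fun x => by
      have := hF.pos x
      have := hF.deriv_pos x
      simp only [bernoulliScore, sub_self, zero_div, sub_zero]
      positivity
  obtain ⟨c₀, C₀, hc₀, h₀⟩ := key (bernoulliScore F f 0) (by
      unfold bernoulliScore
      refine hF.continuous_deriv.mul ((continuous_const.div hF.continuous fun x =>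
        (hF.pos x).ne').sub (continuous_const.div (continuous_const.sub hF.continuous) fun x => by
          linarith [hF.lt_one x]))) fun x => by
      have : 0 < 1 - F x := by linarith [hF.lt_one x]
      have := hF.deriv_pos x
      simp only [bernoulliScore, sub_zero, zero_div, zero_sub]
      exact mul_ne_zero this.ne' (neg_ne_zero.2 (by positivity))
  refine ⟨min c₀ c₁, max C₀ C₁, lt_min hc₀ hc₁, fun δ θ hδ hθ => ?_⟩
  rcases hδ with rfl | rfl
  · exact ⟨(min_le_left _ _).trans (h₀ θ hθ).1, (h₀ θ hθ).2.trans (le_max_left _ _)⟩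
  · exact ⟨(min_le_right _ _).trans (h₁ θ hθ).1, (h₁ θ hθ).2.trans (le_max_right _ _)⟩

end ErrorDistribution

/-! ### Essentially bounded functions and conditional expectations -/

section Bounded

variable {X : Type*} {m m₀ : MeasurableSpace X} {μ : Measure X} {f g : X → ℝ}

theorem memLp_top_mul (hf : MemLp f ∞ μ) (hg : MemLp g ∞ μ) :
    MemLp (fun x => f x * g x) ∞ μ := by
  simpa [Pi.mul_def] using MemLp.mul (p := ∞) (q := ∞) (r := ∞) hg hf

theorem exists_bound_of_memLp_top (hf : MemLp f ∞ μ) : ∃ C, 0 ≤ C ∧ ∀ᵐ x ∂μ, |f x| ≤ C := by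
  have h := hf.2
  rw [eLpNorm_exponent_top] at h
  refine ⟨(eLpNormEssSup f μ).toReal, ENNReal.toReal_nonneg, ?_⟩
  filter_upwards [ae_le_eLpNormEssSup (f := f) (μ := μ)] with x hx
  have := ENNReal.toReal_mono h.ne hx
  simpa using this

theorem memLp_top_condExp [IsFiniteMeasure μ] (hm : m ≤ m₀) (hf : MemLp f ∞ μ) :
    MemLp (μ[f | m]) ∞ μ := by
  obtain ⟨C, hC, h⟩ := exists_bound_of_memLp_top hf
  refine memLp_top_of_bound (stronglyMeasurable_condExp.mono hm).aestronglyMeasurable C ?_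
  exact ae_bdd_abs_condExp_of_ae_bdd_abs h

/-- The conditional expectation is self-adjoint: a factor measurable with respect to `m` pulls out
of it. -/
theorem integral_mul_condExp [IsFiniteMeasure μ] (hm : m ≤ m₀)
    (hr : AEStronglyMeasurable[m] f μ) (hf : MemLp f ∞ μ) (hg : MemLp g ∞ μ) :
    ∫ x, f x * (μ[g | m]) x ∂μ = ∫ x, f x * g x ∂μ := by
  have := condExp_mul_of_aestronglyMeasurable_left (g := g) hr
    ((memLp_top_mul hf hg).integrable le_top) (hg.integrable le_top)
  rw [← integral_condExp hm (f := fun x => f x * g x)]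
  exact (integral_congr_ae this).symm

end Bounded

/-- The residual `ζ - η - q` of the weighted projection is orthogonal to the functions measurable
with respect to `m`, and to every `k` for which the residual `ζ - η` is orthogonal to the centred
version of `k`. -/
theorem weighted_residual_orthogonal {X : Type*} {m m₀ : MeasurableSpace X} {μ : Measure X}
    [IsFiniteMeasure μ] (hm : m ≤ m₀) {w ζ η q : X → ℝ} {c : ℝ} (hc : 0 < c)
    (hw : MemLp w ∞ μ) (hcw : ∀ᵐ x ∂μ, c ≤ w x) (hζ : MemLp ζ ∞ μ) (hη : MemLp η ∞ μ)
    (hq : MemLp q ∞ μ)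
    (hver : q =ᵐ[μ] fun x => (μ[fun x => ζ x * w x | m]) x / (μ[w | m]) x
      - (μ[fun x => η x * w x | m]) x / (μ[w | m]) x) :
    (∀ r, AEStronglyMeasurable[m] r μ → MemLp r ∞ μ →
      ∫ x, (ζ x - η x - q x) * w x * r x ∂μ = 0) ∧
    ∀ k, MemLp k ∞ μ →
      ∫ x, (ζ x - η x) * (k x - (μ[fun x => k x * w x | m]) x / (μ[w | m]) x) * w x ∂μ = 0 →
      ∫ x, (ζ x - η x - q x) * w x * k x ∂μ = 0 := by
  have hcE : ∀ᵐ x ∂μ, c ≤ (μ[w | m]) x := by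
    have := condExp_mono (m := m) (integrable_const c) (hw.integrable le_top) hcw
    rwa [condExp_const hm] at this
  have hq_meas : AEStronglyMeasurable[m] q μ := by
    refine ⟨_, ?_, hver⟩
    exact (stronglyMeasurable_condExp.measurable.div stronglyMeasurable_condExp.measurable |>.sub
      (stronglyMeasurable_condExp.measurable.div
        stronglyMeasurable_condExp.measurable)).stronglyMeasurable
  -- The normal equation for `q`: it is the `w`-weighted projection of `ζ - η` onto the functions
  -- measurable with respect to `m`.
  have hE : ∀ᵐ x ∂μ, (μ[fun x => (ζ x - η x) * w x | m]) x = q x * (μ[w | m]) x := by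
    have h1 := condExp_sub ((memLp_top_mul hζ hw).integrable le_top)
      ((memLp_top_mul hη hw).integrable le_top) m
    have e : (fun x => (ζ x - η x) * w x) = (fun x => ζ x * w x) - fun x => η x * w x := by
      ext x; simp [sub_mul]
    rw [← e] at h1
    filter_upwards [h1, hver, hcE] with x hx hq hcx
    have : (μ[w | m]) x ≠ 0 := by linarith
    rw [hx, hq, Pi.sub_apply]
    field_simp
  have hζη : MemLp (fun x => ζ x - η x) ∞ μ := hζ.sub hη
  have hres : MemLp (fun x => ζ x - η x - q x) ∞ μ := hζη.sub hq
  have first : ∀ r, AEStronglyMeasurable[m] r μ → MemLp r ∞ μ →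
      ∫ x, (ζ x - η x) * w x * r x ∂μ = ∫ x, r x * q x * w x ∂μ := fun r hr hr' => by
    have h1 := integral_mul_condExp hm hr hr' (memLp_top_mul hζη hw)
    have h2 := integral_mul_condExp hm (hr.mul hq_meas) (memLp_top_mul hr' hq) hw
    simp only [Pi.mul_apply] at h2
    rw [← h2]
    trans ∫ x, r x * ((ζ x - η x) * w x) ∂μ
    · congr 1; ext x; ring
    rw [← h1]
    refine integral_congr_ae ?_
    filter_upwards [hE] with x hx
    rw [hx]; ring
  refine ⟨fun r hr hr' => ?_, fun k hk horth => ?_⟩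
  · have h1 := first r hr hr'
    have h2 : ∫ x, (ζ x - η x - q x) * w x * r x ∂μ
        = ∫ x, (ζ x - η x) * w x * r x ∂μ - ∫ x, r x * q x * w x ∂μ := by
      rw [← integral_sub ((memLp_top_mul (memLp_top_mul hζη hw) hr').integrable le_top)
        ((memLp_top_mul (memLp_top_mul hr' hq) hw).integrable le_top)]
      congr 1; ext x; ring
    rw [h2, h1, sub_self]
  · set P : X → ℝ := fun x => (μ[fun x => k x * w x | m]) x / (μ[w | m]) x with hP
    have hPm : AEStronglyMeasurable[m] P μ :=
      (stronglyMeasurable_condExp.measurable.div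
        stronglyMeasurable_condExp.measurable).stronglyMeasurable.aestronglyMeasurable
    have hPb : MemLp P ∞ μ := by
      obtain ⟨C, hC, h⟩ := exists_bound_of_memLp_top
        (memLp_top_condExp hm (memLp_top_mul hk hw))
      refine memLp_top_of_bound (hPm.mono hm) (C / c) ?_
      filter_upwards [h, hcE] with x hx hcx
      rw [hP, Real.norm_eq_abs, abs_div, abs_of_pos (hc.trans_le hcx)]
      gcongr
    have h1 := first P hPm hPb
    -- Replacing `w` by its conditional expectation cancels the denominator of `P`. Thus `k` and its
    -- weighted projection `P` have the same `w`-weighted inner product with `q`.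
    have h2 : ∫ x, P x * q x * w x ∂μ = ∫ x, q x * (k x * w x) ∂μ := by
      have e1 := integral_mul_condExp hm (hPm.mul hq_meas) (memLp_top_mul hPb hq) hw
      have e2 := integral_mul_condExp hm hq_meas hq (memLp_top_mul hk hw)
      simp only [Pi.mul_apply] at e1
      rw [← e1, ← e2]
      refine integral_congr_ae ?_
      filter_upwards [hcE] with x hx
      have : (μ[w | m]) x ≠ 0 := by linarith
      rw [hP]
      field_simp
    have h3 : ∫ x, (ζ x - η x) * (k x - P x) * w x ∂μ
        = ∫ x, (ζ x - η x) * w x * k x ∂μ - ∫ x, (ζ x - η x) * w x * P x ∂μ := by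
      rw [← integral_sub ((memLp_top_mul (memLp_top_mul hζη hw) hk).integrable le_top)
        ((memLp_top_mul (memLp_top_mul hζη hw) hPb).integrable le_top)]
      congr 1; ext x; ring
    have h4 : ∫ x, (ζ x - η x - q x) * w x * k x ∂μ
        = ∫ x, (ζ x - η x) * w x * k x ∂μ - ∫ x, q x * (k x * w x) ∂μ := by
      rw [← integral_sub ((memLp_top_mul (memLp_top_mul hζη hw) hk).integrable le_top)
        ((memLp_top_mul hq (memLp_top_mul hk hw)).integrable le_top)]
      congr 1; ext x; ring
    rw [h4]
    linarith

/-! ### The law of a current status observation -/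

section CurrentStatus

variable {Ω α : Type*} [MeasurableSpace Ω] [MeasurableSpace α] {μ : Measure Ω}
  [IsProbabilityMeasure μ] {U V ρ : Ω → ℝ} {Y : Ω → α} {F H : ℝ → ℝ}

/-- The case of a constant threshold. By conditional independence, the indicators of `U ≤ y` and `V
∈ t` may be integrated over `Y ∈ A` with the first replaced by its conditional probability; this is
`sig Y`-measurable, so the second need not be conditioned. -/
theorem setIntegral_le_const_of_condIndep (hU : Measurable U) (hV : Measurable V)
    (hY : Measurable Y) (hci : CondIndepGiven μ U V Y) {G : Ω → ℝ} {y : ℝ}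
    (htr : (μ[(U ⁻¹' Iic y).indicator fun _ => (1 : ℝ) | sig Y]) =ᵐ[μ] G) {t : Set ℝ}
    (ht : MeasurableSet t) {A : Set α} (hA : MeasurableSet A) :
    ∫ ω in V ⁻¹' t ∩ Y ⁻¹' A, (U ⁻¹' Iic y).indicator (fun _ => (1 : ℝ)) ω ∂μ
      = ∫ ω in V ⁻¹' t ∩ Y ⁻¹' A, G ω ∂μ := by
  have hm : sig Y ≤ (inferInstance : MeasurableSpace Ω) := hY.comap_le
  have hUy : MeasurableSet (U ⁻¹' Iic y) := hU measurableSet_Iic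
  have hVt : MeasurableSet (V ⁻¹' t) := hV ht
  have hYA : MeasurableSet[sig Y] (Y ⁻¹' A) := ⟨A, hA, rfl⟩
  have hind : ∀ s : Set Ω, MeasurableSet s → MemLp (s.indicator fun _ => (1 : ℝ)) ∞ μ :=
    fun s hs => memLp_indicator_const _ hs _ (Or.inr (measure_ne_top _ _))
  set c := μ[(U ⁻¹' Iic y).indicator fun _ => (1 : ℝ) | sig Y] with hcdef
  have hc : MemLp c ∞ μ := memLp_top_condExp hm (hind _ hUy)
  have hcm : StronglyMeasurable[sig Y] c := stronglyMeasurable_condExp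
  have h1 := condExp_mul_of_stronglyMeasurable_left (μ := μ) hcm
    ((memLp_top_mul hc (hind _ hVt)).integrable le_top) ((hind _ hVt).integrable le_top)
  have swap : ∀ k : Ω → ℝ, ∫ ω in V ⁻¹' t ∩ Y ⁻¹' A, k ω ∂μ
      = ∫ ω in Y ⁻¹' A, (V ⁻¹' t).indicator k ω ∂μ := fun k => by
    rw [setIntegral_indicator hVt, inter_comm]
  rw [swap, swap]
  calc ∫ ω in Y ⁻¹' A, (V ⁻¹' t).indicator ((U ⁻¹' Iic y).indicator fun _ => (1 : ℝ)) ω ∂μ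
      = ∫ ω in Y ⁻¹' A, (U ⁻¹' Iic y ∩ V ⁻¹' t).indicator (fun _ => (1 : ℝ)) ω ∂μ := by
        rw [indicator_indicator, inter_comm]
    _ = ∫ ω in Y ⁻¹' A,
          (μ[(U ⁻¹' Iic y ∩ V ⁻¹' t).indicator fun _ => (1 : ℝ) | sig Y]) ω ∂μ :=
        (setIntegral_condExp hm ((hind _ (hUy.inter hVt)).integrable le_top) hYA).symm
    _ = ∫ ω in Y ⁻¹' A, (μ[c * (V ⁻¹' t).indicator fun _ => (1 : ℝ) | sig Y]) ω ∂μ := by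
        refine integral_congr_ae (ae_restrict_of_ae ?_)
        filter_upwards [hci (Iic y) t measurableSet_Iic ht, h1] with ω e1 e2
        rw [e1, e2]
    _ = ∫ ω in Y ⁻¹' A, (c * (V ⁻¹' t).indicator fun _ => (1 : ℝ)) ω ∂μ :=
        setIntegral_condExp hm ((memLp_top_mul hc (hind _ hVt)).integrable le_top) hYA
    _ = ∫ ω in Y ⁻¹' A, (V ⁻¹' t).indicator G ω ∂μ := by
        refine integral_congr_ae (ae_restrict_of_ae ?_)
        filter_upwards [htr] with ω e1
        by_cases hω : ω ∈ V ⁻¹' t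
        · simp only [Pi.mul_apply, indicator_of_mem hω, mul_one]; exact e1
        · simp [indicator_of_notMem hω]

/-- Right continuity is inherited from the distribution function of `U`: dominated convergence along
`y + 1 / (n + 1)` equates the means of `F (ρ + H y)` and of `F (ρ + H (y+))`, while a jump of `H`
would separate them strictly. -/
theorem rightContinuous_of_condExp (hU : Measurable U) (hY : Measurable Y)
    (hF : StrictMono F) (hFc : Continuous F) (hF0 : ∀ x, 0 ≤ F x) (hF1 : ∀ x, F x ≤ 1)
    (hH : Monotone H) (hρ : AEMeasurable ρ μ)
    (htr : ∀ y, (μ[(U ⁻¹' Iic y).indicator fun _ => (1 : ℝ) | sig Y]) =ᵐ[μ]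
      fun ω => F (ρ ω + H y)) (y : ℝ) : ContinuousWithinAt H (Ioi y) y := by
  have hm : sig Y ≤ (inferInstance : MeasurableSpace Ω) := hY.comap_le
  rw [hH.continuousWithinAt_Ioi_iff_rightLim_eq]
  have hFm : ∀ x, MemLp (fun ω => F (ρ ω + x)) ∞ μ := fun x =>
    memLp_top_of_bound (hFc.measurable.comp_aemeasurable
      (hρ.add_const x)).aestronglyMeasurable 1 (ae_of_all _ fun ω => by
        rw [Real.norm_eq_abs, abs_le]; constructor <;> linarith [hF0 (ρ ω + x), hF1 (ρ ω + x)])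
  have hint : ∀ z, ∫ ω, (U ⁻¹' Iic z).indicator (fun _ => (1 : ℝ)) ω ∂μ
      = ∫ ω, F (ρ ω + H z) ∂μ := fun z => by
    rw [← integral_condExp hm]; exact integral_congr_ae (htr z)
  let yn : ℕ → ℝ := fun n => y + 1 / ((n : ℝ) + 1)
  have hyn0 : Tendsto yn atTop (𝓝 y) := by
    simpa [yn] using (tendsto_one_div_add_atTop_nhds_zero_nat (𝕜 := ℝ)).const_add y
  have hyn1 : ∀ n, y < yn n := fun n => by
    have : (0 : ℝ) < 1 / ((n : ℝ) + 1) := by positivity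
    simp only [yn]; linarith
  have hyn : Tendsto yn atTop (𝓝[>] y) :=
    tendsto_nhdsWithin_iff.2 ⟨hyn0, Eventually.of_forall hyn1⟩
  have L1 : Tendsto (fun n => ∫ ω, (U ⁻¹' Iic (yn n)).indicator (fun _ => (1 : ℝ)) ω ∂μ) atTop
      (𝓝 (∫ ω, (U ⁻¹' Iic y).indicator (fun _ => (1 : ℝ)) ω ∂μ)) := by
    refine tendsto_integral_of_dominated_convergence (fun _ => 1)
      (fun n => (measurable_const.indicator (hU measurableSet_Iic)).aestronglyMeasurable)
      (integrable_const _) (fun n => ae_of_all _ fun ω => ?_) (ae_of_all _ fun ω => ?_)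
    · exact (norm_indicator_le_norm_self _ _).trans (by simp)
    · by_cases hω : U ω ≤ y
      · refine tendsto_const_nhds.congr fun n => ?_
        rw [indicator_of_mem (show ω ∈ U ⁻¹' Iic y from hω),
          indicator_of_mem (show ω ∈ U ⁻¹' Iic (yn n) from hω.trans (hyn1 n).le)]
      · push Not at hω
        refine tendsto_const_nhds.congr' ?_
        filter_upwards [hyn0.eventually (gt_mem_nhds hω)] with n hn
        rw [indicator_of_notMem (show ω ∉ U ⁻¹' Iic y from not_le.2 hω),
          indicator_of_notMem (show ω ∉ U ⁻¹' Iic (yn n) from not_le.2 hn)]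
  have L2 : Tendsto (fun n => ∫ ω, F (ρ ω + H (yn n)) ∂μ) atTop
      (𝓝 (∫ ω, F (ρ ω + Function.rightLim H y) ∂μ)) := by
    refine tendsto_integral_of_dominated_convergence (fun _ => 1)
      (fun n => (hFm _).1) (integrable_const _) (fun n => ae_of_all _ fun ω => ?_)
      (ae_of_all _ fun ω => ?_)
    · rw [Real.norm_eq_abs, abs_le]
      constructor <;> linarith [hF0 (ρ ω + H (yn n)), hF1 (ρ ω + H (yn n))]
    · exact (hFc.tendsto _).comp (((hH.tendsto_rightLim y).comp hyn).const_add (ρ ω))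
  simp only [hint] at L1
  have heq := tendsto_nhds_unique L2 L1
  by_contra hne
  have hlt : H y < Function.rightLim H y := lt_of_le_of_ne (hH.le_rightLim le_rfl) (Ne.symm hne)
  have : ∫ ω, F (ρ ω + H y) ∂μ < ∫ ω, F (ρ ω + Function.rightLim H y) ∂μ := by
    have hpos : ∀ ω, 0 < F (ρ ω + Function.rightLim H y) - F (ρ ω + H y) :=
      fun ω => sub_pos.2 (hF (by linarith))
    rw [← sub_pos, ← integral_sub ((hFm _).integrable le_top) ((hFm _).integrable le_top),
      integral_pos_iff_support_of_nonneg (fun ω => (hpos ω).le)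
        (((hFm _).integrable le_top).sub ((hFm _).integrable le_top))]
    have : (Function.support fun ω => F (ρ ω + Function.rightLim H y) - F (ρ ω + H y)) = univ :=
      eq_univ_of_forall fun ω => (hpos ω).ne'
    rw [this]; simp
  exact this.ne heq.symm

/-- The random threshold `V` is replaced by a countably valued one just above it, for which the
constant case applies cell by cell; right continuity of `H` then permits passage to the limit. -/
theorem setIntegral_current_status (hU : Measurable U) (hV : Measurable V) (hY : Measurable Y)
    (hF : StrictMono F) (hFc : Continuous F) (hF0 : ∀ x, 0 ≤ F x) (hF1 : ∀ x, F x ≤ 1)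
    (hH : Monotone H) (hρ : AEMeasurable ρ μ) (hci : CondIndepGiven μ U V Y)
    (htr : ∀ y, (μ[(U ⁻¹' Iic y).indicator fun _ => (1 : ℝ) | sig Y]) =ᵐ[μ]
      fun ω => F (ρ ω + H y)) {t : Set ℝ} (ht : MeasurableSet t) {A : Set α}
    (hA : MeasurableSet A) :
    ∫ ω in V ⁻¹' t ∩ Y ⁻¹' A, {ω | U ω ≤ V ω}.indicator (fun _ => (1 : ℝ)) ω ∂μ
      = ∫ ω in V ⁻¹' t ∩ Y ⁻¹' A, F (ρ ω + H (V ω)) ∂μ := by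
  -- `κ n v` indexes the cell of mesh `1 / (n + 1)` containing `v`, and `r n` gives its right
  -- endpoint. The endpoint lies strictly above `v`, so convergence is within `𝓝[>] v` and the
  -- events `U ≤ r n (κ n V)` converge to `U ≤ V`, ties included.
  let κ : ℕ → ℝ → ℤ := fun n v => ⌊((n : ℝ) + 1) * v⌋
  let r : ℕ → ℤ → ℝ := fun n k => ((k : ℝ) + 1) / ((n : ℝ) + 1)
  have hκ : ∀ n, Measurable (κ n) := fun n => Int.measurable_floor.comp (measurable_const_mul _)
  have hrm : ∀ n, Measurable (r n) := fun n => measurable_of_countable _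
  have hlt : ∀ n v, v < r n (κ n v) := fun n v => by
    have h := Int.lt_floor_add_one (((n : ℝ) + 1) * v)
    simp only [r, κ]
    rw [lt_div_iff₀ (by positivity)]; linarith
  have hle : ∀ n v, r n (κ n v) ≤ v + 1 / ((n : ℝ) + 1) := fun n v => by
    have h := Int.floor_le (((n : ℝ) + 1) * v)
    simp only [r, κ]
    rw [div_le_iff₀ (by positivity), add_mul v, div_mul_cancel₀ _ (by positivity)]; linarith
  have hlim : ∀ v, Tendsto (fun n => r n (κ n v)) atTop (𝓝[>] v) := fun v => by
    refine tendsto_nhdsWithin_iff.2 ⟨?_, Eventually.of_forall fun n => hlt n v⟩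
    refine tendsto_of_tendsto_of_tendsto_of_le_of_le tendsto_const_nhds ?_
      (fun n => (hlt n v).le) (fun n => hle n v)
    simpa using tendsto_one_div_add_atTop_nhds_zero_nat.const_add v
  have hrV : ∀ n, Measurable fun ω => r n (κ n (V ω)) := fun n =>
    (hrm n).comp ((hκ n).comp hV)
  have hS : ∀ n, MeasurableSet {ω | U ω ≤ r n (κ n (V ω))} := fun n =>
    measurableSet_le hU (hrV n)
  have hFm : ∀ n, AEStronglyMeasurable (fun ω => F (ρ ω + H (r n (κ n (V ω))))) μ := fun n =>
    (hFc.measurable.comp_aemeasurable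
      (hρ.add (hH.measurable.comp (hrV n)).aemeasurable)).aestronglyMeasurable
  have hFb : ∀ x, ‖F x‖ ≤ 1 := fun x => by
    rw [Real.norm_eq_abs, abs_le]; constructor <;> linarith [hF0 x, hF1 x]
  have step : ∀ n, ∫ ω in V ⁻¹' t ∩ Y ⁻¹' A,
        {ω | U ω ≤ r n (κ n (V ω))}.indicator (fun _ => (1 : ℝ)) ω ∂μ
      = ∫ ω in V ⁻¹' t ∩ Y ⁻¹' A, F (ρ ω + H (r n (κ n (V ω)))) ∂μ := fun n => by
    let s : ℤ → Set Ω := fun k => V ⁻¹' (t ∩ κ n ⁻¹' {k}) ∩ Y ⁻¹' A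
    have hs : ∀ k, MeasurableSet (s k) := fun k =>
      (hV (ht.inter (hκ n (measurableSet_singleton k)))).inter (hY hA)
    have hunion : V ⁻¹' t ∩ Y ⁻¹' A = ⋃ k, s k := by
      ext ω; simp [s]
    have hdisj : Pairwise (Function.onFun Disjoint s) := fun j k hjk => by
      refine disjoint_left.2 fun ω h1 h2 => hjk ?_
      have h3 : κ n (V ω) = j := h1.1.2
      have h4 : κ n (V ω) = k := h2.1.2
      rw [← h3, h4]
    rw [hunion, integral_iUnion hs hdisj (Integrable.integrableOn
        (.of_bound (measurable_const.indicator (hS n)).aestronglyMeasurable 1 (ae_of_all _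
          fun ω => (norm_indicator_le_norm_self _ _).trans (by simp)))),
      integral_iUnion hs hdisj (Integrable.integrableOn (.of_bound (hFm n) 1 (ae_of_all _
          fun ω => hFb _)))]
    congr 1
    ext k
    have hk : ∀ ω ∈ s k, κ n (V ω) = k := fun ω hω => hω.1.2
    have := setIntegral_le_const_of_condIndep hU hV hY hci (htr (r n k))
      (ht.inter (hκ n (measurableSet_singleton k))) hA
    refine Eq.trans ?_ (this.trans ?_)
    · refine setIntegral_congr_fun (hs k) fun ω hω => ?_
      simp only [indicator, mem_ofPred_eq, mem_preimage, mem_Iic, hk ω hω]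
    · refine setIntegral_congr_fun (hs k) fun ω hω => ?_
      simp only [hk ω hω]
  have L1 : Tendsto (fun n => ∫ ω in V ⁻¹' t ∩ Y ⁻¹' A,
        {ω | U ω ≤ r n (κ n (V ω))}.indicator (fun _ => (1 : ℝ)) ω ∂μ) atTop
      (𝓝 (∫ ω in V ⁻¹' t ∩ Y ⁻¹' A, {ω | U ω ≤ V ω}.indicator (fun _ => (1 : ℝ)) ω ∂μ)) := by
    refine tendsto_integral_of_dominated_convergence (fun _ => 1)
      (fun n => (measurable_const.indicator (hS n)).aestronglyMeasurable)
      (integrable_const _) (fun n => ae_of_all _ fun ω => ?_) (ae_of_all _ fun ω => ?_)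
    · exact (norm_indicator_le_norm_self _ _).trans (by simp)
    · by_cases hω : U ω ≤ V ω
      · refine tendsto_const_nhds.congr fun n => ?_
        rw [indicator_of_mem (show ω ∈ {ω | U ω ≤ V ω} from hω), indicator_of_mem
          (show ω ∈ {ω | U ω ≤ r n (κ n (V ω))} from hω.trans (hlt n _).le)]
      · push Not at hω
        refine tendsto_const_nhds.congr' ?_
        filter_upwards [((hlim (V ω)).mono_right nhdsWithin_le_nhds).eventually
          (gt_mem_nhds hω)] with n hn
        rw [indicator_of_notMem (show ω ∉ {ω | U ω ≤ V ω} from not_le.2 hω), indicator_of_notMem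
          (show ω ∉ {ω | U ω ≤ r n (κ n (V ω))} from not_le.2 hn)]
  have L2 : Tendsto (fun n => ∫ ω in V ⁻¹' t ∩ Y ⁻¹' A, F (ρ ω + H (r n (κ n (V ω)))) ∂μ) atTop
      (𝓝 (∫ ω in V ⁻¹' t ∩ Y ⁻¹' A, F (ρ ω + H (V ω)) ∂μ)) := by
    refine tendsto_integral_of_dominated_convergence (fun _ => 1)
      (fun n => (hFm n).restrict) (integrable_const _) (fun n => ae_of_all _ fun ω => hFb _)
      (ae_of_all _ fun ω => ?_)
    refine (hFc.tendsto _).comp (Tendsto.const_add (ρ ω) ?_)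
    exact (rightContinuous_of_condExp hU hY hF hFc hF0 hF1 hH hρ htr (V ω)).tendsto.comp
      (hlim (V ω))
  simp only [step] at L1
  exact tendsto_nhds_unique L1 L2

end CurrentStatus

/-! ### Sobolev classes -/

section Sobolev

variable {ν : ℕ} {a b : ℝ} {h k : ℝ → ℝ} {PW : Measure ℝ}

theorem MemSobolev.continuousOn (hν : 0 < ν) (hab : a ≤ b) (hh : MemSobolev ν a b h) :
    ContinuousOn h (Icc a b) := by
  obtain ⟨D, hD0, hD, -⟩ := hh
  obtain ⟨hi, hD1⟩ := hD 0 hν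
  have : ContinuousOn (fun x => D 0 a + ∫ t in a..x, D (0 + 1) t) (Icc a b) := by
    have := intervalIntegral.continuousOn_primitive_interval (μ := volume) (a := a) (b := b)
      (f := D (0 + 1)) (by rwa [uIcc_of_le hab])
    rw [uIcc_of_le hab] at this
    exact continuousOn_const.add this
  exact this.congr fun x hx => by rw [← hD0 x hx, hD1 x hx]

theorem MemSobolev.add_const_mul (hh : MemSobolev ν a b h) (hk : MemSobolev ν a b k) (c : ℝ) :
    MemSobolev ν a b fun w => h w + c * k w := by
  obtain ⟨D, hD0, hD, hDν⟩ := hh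
  obtain ⟨E, hE0, hE, hEν⟩ := hk
  refine ⟨fun j x => D j x + c * E j x, fun x hx => by simp only [hD0 x hx, hE0 x hx],
    fun j hj => ⟨(hD j hj).1.add ((hE j hj).1.const_mul c), fun x hx => ?_⟩,
    hDν.add (hEν.const_mul c)⟩
  have hsub : uIcc a x ⊆ Icc a b := by
    rw [uIcc_of_le hx.1]; exact Icc_subset_Icc_right hx.2
  have i1 : IntervalIntegrable (D (j + 1)) volume a x :=
    ((hD j hj).1.mono_set hsub).intervalIntegrable
  have i2 : IntervalIntegrable (E (j + 1)) volume a x :=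
    ((hE j hj).1.mono_set hsub).intervalIntegrable
  simp only
  rw [intervalIntegral.integral_add i1 (i2.const_mul c), intervalIntegral.integral_const_mul,
    (hD j hj).2 x hx, (hE j hj).2 x hx]
  ring

end Sobolev

/-! ### Essential boundedness of functions of the data -/

section Composition

variable {X : Type*} [MeasurableSpace X] {μ : Measure X} {a b : ℝ} {g : X → ℝ} {h : ℝ → ℝ}

theorem memLp_top_comp_continuousOn (hh : ContinuousOn h (Icc a b)) (hg : Measurable g)
    (hgm : ∀ᵐ x ∂μ, g x ∈ Icc a b) : MemLp (fun x => h (g x)) ∞ μ := by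
  obtain ⟨C, hC⟩ := (isCompact_Icc (a := a) (b := b)).exists_bound_of_continuousOn hh
  -- Outside `[a, b]` the function `h` is arbitrary, possibly not measurable; its extension by zero
  -- serves as a measurable version.
  refine memLp_top_of_bound (AEMeasurable.aestronglyMeasurable
    ⟨fun x => (Icc a b).piecewise h (fun _ => 0) (g x), ?_, ?_⟩) C ?_
  · exact (hh.measurable_piecewise continuousOn_const measurableSet_Icc).comp hg
  · filter_upwards [hgm] with x hx
    rw [piecewise_eq_of_mem _ _ _ hx]
  · filter_upwards [hgm] with x hx using hC _ hx

theorem memLp_top_comp_monotone (hh : Monotone h) (hg : Measurable g)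
    (hgm : ∀ᵐ x ∂μ, g x ∈ Icc a b) : MemLp (fun x => h (g x)) ∞ μ := by
  refine memLp_top_of_bound (hh.measurable.comp hg).aestronglyMeasurable (max |h a| |h b|) ?_
  filter_upwards [hgm] with x hx
  exact abs_le_max_abs_abs (hh hx.1) (hh hx.2)

end Composition

theorem ae_mem_of_support_map_eq {Ω : Type*} [MeasurableSpace Ω] {μ : Measure Ω} {W : Ω → ℝ}
    {s : Set ℝ} (hW : Measurable W) (h : (μ.map W).support = s) : ∀ᵐ ω ∂μ, W ω ∈ s := by
  refine ae_of_ae_map hW.aemeasurable ?_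
  rw [← h]
  exact Measure.support_mem_ae

/-- Closure of the centred class under perturbations. -/
theorem MemSobolevCentred.add_const_mul {ν : ℕ} {a b : ℝ} {h k : ℝ → ℝ} {PW : Measure ℝ}
    [IsFiniteMeasure PW] (hν : 0 < ν) (hab : a ≤ b) (hPW : ∀ᵐ w ∂PW, w ∈ Icc a b)
    (hh : MemSobolevCentred ν a b PW h) (hk : MemSobolevCentred ν a b PW k) (c : ℝ) :
    MemSobolevCentred ν a b PW fun w => h w + c * k w := by
  refine ⟨hh.1.add_const_mul hk.1 c, ?_⟩
  have i1 : MemLp h ∞ PW :=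
    memLp_top_comp_continuousOn (hh.1.continuousOn hν hab) measurable_id hPW
  have i2 : MemLp k ∞ PW :=
    memLp_top_comp_continuousOn (hk.1.continuousOn hν hab) measurable_id hPW
  rw [integral_add (i1.integrable le_top) ((i2.integrable le_top).const_mul c),
    integral_const_mul, hh.2, hk.2]
  simp

/-! ### Observations in the range of the data -/

variable {d : ℕ}

/-- The observations `(v, δ, z, w)` with `v ∈ [l, u]`, `δ ∈ {0, 1}`, `‖z‖ ≤ C` and
`w ∈ [a, b]`. -/
def obsRange (d : ℕ) (a b l u C : ℝ) : Set (Obs d) :=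
  {x | x.1 ∈ Icc l u ∧ (x.2.1 = 0 ∨ x.2.1 = 1) ∧ ‖x.2.2.1‖ ≤ C ∧ x.2.2.2 ∈ Icc a b}

/-- The observation with status `δ` and covariates `(v, z, w)`. -/
def withStatus (δ : ℝ) (y : ℝ × EuclideanSpace ℝ (Fin d) × ℝ) : Obs d := (y.1, δ, y.2.1, y.2.2)

theorem measurable_withStatus (δ : ℝ) : Measurable (withStatus (d := d) δ) := by
  unfold withStatus; fun_prop

/-- Splitting along the two statuses reduces assertions about the dominating measure to assertions
about the law of the covariates. -/
theorem domMeasure_eq (G : Measure (ℝ × EuclideanSpace ℝ (Fin d) × ℝ)) [SFinite G] :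
    domMeasure G = G.map (withStatus 0) + G.map (withStatus 1) := by
  have hm : Measurable fun y : ℝ × ℝ × EuclideanSpace ℝ (Fin d) × ℝ =>
      (y.2.1, y.1, y.2.2.1, y.2.2.2) := by fun_prop
  rw [domMeasure, Measure.add_prod, Measure.map_add _ _ hm, Measure.dirac_prod,
    Measure.dirac_prod, Measure.map_map hm (by fun_prop), Measure.map_map hm (by fun_prop)]
  rfl

instance isFiniteMeasure_domMeasure (G : Measure (ℝ × EuclideanSpace ℝ (Fin d) × ℝ))
    [IsFiniteMeasure G] : IsFiniteMeasure (domMeasure G) := by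
  rw [domMeasure_eq]; infer_instance

section Range

variable {a b l u C : ℝ} {P : Measure (Obs d)} {F f f' : ℝ → ℝ} {h H : ℝ → ℝ}
  {β : EuclideanSpace ℝ (Fin d)}

theorem memLp_top_covariate (hP : ∀ᵐ x ∂P, x ∈ obsRange d a b l u C) (i : Fin d) :
    MemLp (fun x : Obs d => x.2.2.1 i) ∞ P := by
  refine memLp_top_of_bound (by fun_prop) C ?_
  filter_upwards [hP] with x hx
  exact (PiLp.norm_apply_le _ _).trans hx.2.2.1

theorem memLp_top_inner_covariate (hP : ∀ᵐ x ∂P, x ∈ obsRange d a b l u C) :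
    MemLp (fun x : Obs d => inner ℝ β x.2.2.1) ∞ P := by
  refine memLp_top_of_bound (by fun_prop) (‖β‖ * C) ?_
  filter_upwards [hP] with x hx
  exact (norm_inner_le_norm _ _).trans (mul_le_mul_of_nonneg_left hx.2.2.1 (norm_nonneg _))

theorem memLp_top_theta (hP : ∀ᵐ x ∂P, x ∈ obsRange d a b l u C)
    (hh : ContinuousOn h (Icc a b)) (hH : Monotone H) : MemLp (theta β h H) ∞ P := by
  have h1 : MemLp (fun x : Obs d => h x.2.2.2) ∞ P :=
    memLp_top_comp_continuousOn hh (by fun_prop) (hP.mono fun x hx => hx.2.2.2)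
  have h2 : MemLp (fun x : Obs d => H x.1) ∞ P :=
    memLp_top_comp_monotone hH (by fun_prop) (hP.mono fun x hx => hx.1)
  exact ((memLp_top_inner_covariate hP).add h1).add h2

theorem aemeasurable_bernoulliDens (hF : ErrorDistribution F f f') {ϑ : Obs d → ℝ}
    (hϑ : AEMeasurable ϑ P) : AEMeasurable (fun x => bernoulliDens F x.2.1 (ϑ x)) P := by
  have := hF.continuous.measurable.comp_aemeasurable hϑ
  have h1 : AEMeasurable (fun x : Obs d => x.2.1) P := by fun_prop
  exact (h1.mul this).add ((h1.const_sub 1).mul (this.const_sub 1))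

theorem memLp_top_Qfun (hF : ErrorDistribution F f f')
    (hP : ∀ᵐ x ∂P, x ∈ obsRange d a b l u C) (hϑ : MemLp (theta β h H) ∞ P) :
    MemLp (Qfun F f β h H) ∞ P := by
  obtain ⟨R, -, hR⟩ := exists_bound_of_memLp_top hϑ
  obtain ⟨_, B, -, hB⟩ := hF.exists_score_bounds R
  have m1 := hF.continuous.measurable.comp_aemeasurable hϑ.1.aemeasurable
  have m2 := hF.continuous_deriv.measurable.comp_aemeasurable hϑ.1.aemeasurable
  have h1 : AEMeasurable (fun x : Obs d => x.2.1) P := by fun_prop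
  refine memLp_top_of_bound (m2.mul ((h1.div m1).sub
    ((h1.const_sub 1).div (m1.const_sub 1)))).aestronglyMeasurable B ?_
  filter_upwards [hP, hR] with x hx hRx
  exact (hB x.2.1 _ hx.2.1 hRx).2

theorem exists_le_sq_Qfun (hF : ErrorDistribution F f f')
    (hP : ∀ᵐ x ∂P, x ∈ obsRange d a b l u C) (hϑ : MemLp (theta β h H) ∞ P) :
    ∃ c, 0 < c ∧ ∀ᵐ x ∂P, c ≤ Qfun F f β h H x ^ 2 := by
  obtain ⟨R, -, hR⟩ := exists_bound_of_memLp_top hϑ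
  obtain ⟨c, _, hc, hB⟩ := hF.exists_score_bounds R
  refine ⟨c, hc, ?_⟩
  filter_upwards [hP, hR] with x hx hRx
  exact (hB x.2.1 _ hx.2.1 hRx).1

end Range

/-! ### The law of the observation -/

section Law

variable {Ω : Type*} [MeasurableSpace Ω] {μ : Measure Ω} [IsProbabilityMeasure μ]
  {U V W : Ω → ℝ} {Z : Ω → EuclideanSpace ℝ (Fin d)} {F f f' : ℝ → ℝ} {h H : ℝ → ℝ}
  {β : EuclideanSpace ℝ (Fin d)} {a b l u : ℝ}

theorem measurable_obs (hU : Measurable U) (hV : Measurable V) (hZ : Measurable Z)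
    (hW : Measurable W) : Measurable (obs U V Z W) :=
  hV.prodMk ((measurable_const.indicator (measurableSet_le hU hV)).prodMk (hZ.prodMk hW))

theorem ae_obs_mem_obsRange (hV : Measurable V) (hW : Measurable W)
    (hdata : DataAssumptions μ U V Z W a b l u F β h H) :
    ∃ C, ∀ᵐ ω ∂μ, ∀ δ, δ = 0 ∨ δ = 1 →
      withStatus δ (V ω, Z ω, W ω) ∈ obsRange d a b l u C := by
  obtain ⟨C, hC⟩ := hdata.bdd_Z
  refine ⟨C, ?_⟩
  filter_upwards [hC, ae_mem_of_support_map_eq hV hdata.support_V,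
    ae_mem_of_support_map_eq hW hdata.support_W] with ω h1 h2 h3 δ hδ
  exact ⟨h2, hδ, h1, h3⟩

theorem measurableSet_obsRange (a b l u C : ℝ) : MeasurableSet (obsRange d a b l u C) := by
  have e : obsRange d a b l u C = (fun x : Obs d => x.1) ⁻¹' Icc l u ∩
      ((fun x : Obs d => x.2.1) ⁻¹' {0, 1} ∩ ((fun x : Obs d => ‖x.2.2.1‖) ⁻¹' Iic C ∩
        (fun x : Obs d => x.2.2.2) ⁻¹' Icc a b)) := by
    ext x; simp [obsRange]
  rw [e]
  exact (measurableSet_Icc.preimage (by fun_prop)).inter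
    (((toFinite _).measurableSet.preimage (by fun_prop)).inter
      ((measurableSet_Iic.preimage (by fun_prop)).inter
        (measurableSet_Icc.preimage (by fun_prop))))

omit [IsProbabilityMeasure μ] in
theorem ae_map_withStatus (hV : Measurable V) (hZ : Measurable Z) (hW : Measurable W) {C : ℝ}
    (hC : ∀ᵐ ω ∂μ, ∀ δ, δ = 0 ∨ δ = 1 →
      withStatus δ (V ω, Z ω, W ω) ∈ obsRange d a b l u C) {δ : ℝ} (hδ : δ = 0 ∨ δ = 1) :
    ∀ᵐ x ∂((μ.map fun ω => (V ω, Z ω, W ω)).map (withStatus δ)), x ∈ obsRange d a b l u C := by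
  have hY : Measurable fun ω => (V ω, Z ω, W ω) := hV.prodMk (hZ.prodMk hW)
  rw [Measure.map_map (measurable_withStatus δ) hY]
  refine (ae_map_iff ((measurable_withStatus δ).comp hY).aemeasurable
    (measurableSet_obsRange a b l u C)).2 ?_
  exact hC.mono fun ω hω => hω δ hδ

theorem withDensity_map_eq {α α' : Type*} [MeasurableSpace α] [MeasurableSpace α']
    {G : Measure α} {e : α → α'} (he : Measurable e) {p : α' → ℝ≥0∞}
    (hp : AEMeasurable p (G.map e)) :
    (G.map e).withDensity p = (G.withDensity (p ∘ e)).map e := by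
  ext A hA
  rw [withDensity_apply _ hA, Measure.map_apply he hA, withDensity_apply _ (he hA),
    Measure.restrict_map he hA, lintegral_map' (by
      rw [← Measure.restrict_map he hA]; exact hp.restrict) he.aemeasurable]
  rfl

/-- Given the covariates, the status is Bernoulli with parameter `F (β'z + h(w) + H(v))`. -/
theorem map_obs_eq_withDensity (hF : ErrorDistribution F f f') (hU : Measurable U)
    (hV : Measurable V) (hZ : Measurable Z) (hW : Measurable W)
    (hdata : DataAssumptions μ U V Z W a b l u F β h H)
    (hh : ContinuousOn h (Icc a b)) (hH : Monotone H) :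
    μ.map (obs U V Z W) = (domMeasure (μ.map fun ω => (V ω, Z ω, W ω))).withDensity
      fun x => ENNReal.ofReal (bernoulliDens F x.2.1 (theta β h H x)) := by
  set Y : Ω → ℝ × EuclideanSpace ℝ (Fin d) × ℝ := fun ω => (V ω, Z ω, W ω) with hYdef
  have hY : Measurable Y := hV.prodMk (hZ.prodMk hW)
  obtain ⟨C, hC⟩ := ae_obs_mem_obsRange hV hW hdata
  have hWm : ∀ᵐ ω ∂μ, W ω ∈ Icc a b := ae_mem_of_support_map_eq hW hdata.support_W
  set S : Set Ω := {ω | U ω ≤ V ω} with hS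
  have hSm : MeasurableSet S := measurableSet_le hU hV
  set G := μ.map Y with hG
  have hGrange : ∀ δ, δ = 0 ∨ δ = 1 → ∀ᵐ x ∂(G.map (withStatus δ)), x ∈ obsRange d a b l u C := by
    exact fun δ hδ => ae_map_withStatus hV hZ hW hC hδ
  have hpm : ∀ δ, δ = 0 ∨ δ = 1 → AEMeasurable (fun x =>
      ENNReal.ofReal (bernoulliDens F x.2.1 (theta β h H x))) (G.map (withStatus δ)) :=
    fun δ hδ => (aemeasurable_bernoulliDens hF
      (memLp_top_theta (hGrange δ hδ) hh hH).1.aemeasurable).ennreal_ofReal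
  -- the conditional success probability
  have hρ : AEMeasurable (fun ω => inner ℝ β (Z ω) + h (W ω)) μ :=
    AEMeasurable.add (by fun_prop) (memLp_top_comp_continuousOn hh hW hWm).1.aemeasurable
  have hci : CondIndepGiven μ U V fun ω => (Z ω, W ω) := hdata.condIndep
  have hpY : AEMeasurable (fun y => F (theta β h H (withStatus 1 y))) G := by
    have := (memLp_top_theta (hGrange 1 (Or.inr rfl)) hh hH (β := β)).1.aemeasurable
    exact hF.continuous.measurable.comp_aemeasurable
      (this.comp_measurable (measurable_withStatus 1))
  have hFm : AEMeasurable (fun ω => F (theta β h H (withStatus 1 (Y ω)))) μ :=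
    hpY.comp_measurable hY
  have hFb : ∀ x, ‖F x‖ ≤ 1 := fun x => by
    rw [Real.norm_eq_abs, abs_le]; constructor <;> linarith [hF.nonneg x, hF.le_one x]
  -- Rectangles determine the measure, and the preimage of a rectangle is an event of the form
  -- treated in `setIntegral_current_status`.
  have one : (μ.restrict S).map Y
      = G.withDensity fun y => ENNReal.ofReal (F (theta β h H (withStatus 1 y))) := by
    refine Measure.ext_prod fun {t A} ht hA => ?_
    have htA := ht.prod hA
    rw [Measure.map_apply hY htA, Measure.restrict_apply (hY htA), withDensity_apply _ htA,
      hG, Measure.restrict_map hY htA, lintegral_map' (by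
        rw [← Measure.restrict_map hY htA]; exact hpY.ennreal_ofReal.restrict) hY.aemeasurable]
    have key := setIntegral_current_status hU hV (hZ.prodMk hW) hF.strictMono hF.continuous
      hF.nonneg hF.le_one hH hρ hci hdata.transformation ht hA
    have e : Y ⁻¹' t ×ˢ A = V ⁻¹' t ∩ (fun ω => (Z ω, W ω)) ⁻¹' A := rfl
    rw [e, ← ofReal_integral_eq_lintegral_ofReal]
    · have : ∫ ω in V ⁻¹' t ∩ (fun ω => (Z ω, W ω)) ⁻¹' A,
          F (theta β h H (withStatus 1 (Y ω))) ∂μ = _ := key.symm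
      rw [this, setIntegral_indicator hSm, setIntegral_const, smul_eq_mul, mul_one,
        ofReal_measureReal]
    · exact (Integrable.of_bound hFm.aestronglyMeasurable 1 (ae_of_all _ fun ω => hFb _)).restrict
    · exact ae_of_all _ fun ω => hF.nonneg _
  -- Obtained by subtraction: on both sides, adding the part with status one gives the finite
  -- measure `G`.
  have zero : (μ.restrict Sᶜ).map Y
      = G.withDensity fun y => ENNReal.ofReal (1 - F (theta β h H (withStatus 1 y))) := by
    have s1 : (μ.restrict S).map Y + (μ.restrict Sᶜ).map Y = G := by
      rw [← Measure.map_add _ _ hY, Measure.restrict_add_restrict_compl hSm]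
    have s2 : (G.withDensity fun y => ENNReal.ofReal (F (theta β h H (withStatus 1 y))))
        + (G.withDensity fun y => ENNReal.ofReal (1 - F (theta β h H (withStatus 1 y)))) = G := by
      ext A hA
      rw [Measure.add_apply, withDensity_apply _ hA, withDensity_apply _ hA,
        ← lintegral_add_left' hpY.ennreal_ofReal.restrict]
      simp_rw [← ENNReal.ofReal_add (hF.nonneg _) (sub_nonneg.2 (hF.le_one _)),
        add_sub_cancel, ENNReal.ofReal_one]
      simp
    ext A hA
    have h1 := congrArg (fun ν : Measure _ => ν A) (s1.trans s2.symm)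
    simp only [Measure.add_apply] at h1
    rw [← one] at h1
    exact (ENNReal.add_right_inj (measure_ne_top _ _)).1 h1
  have e1 : (μ.restrict S).map (obs U V Z W) = ((μ.restrict S).map Y).map (withStatus 1) := by
    rw [Measure.map_map (measurable_withStatus 1) hY]
    refine Measure.map_congr ?_
    filter_upwards [ae_restrict_mem hSm] with ω hω
    simp [obs, withStatus, Y, indicator_of_mem (show ω ∈ {ω' | U ω' ≤ V ω'} from hω)]
  have e0 : (μ.restrict Sᶜ).map (obs U V Z W) = ((μ.restrict Sᶜ).map Y).map (withStatus 0) := by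
    rw [Measure.map_map (measurable_withStatus 0) hY]
    refine Measure.map_congr ?_
    filter_upwards [ae_restrict_mem hSm.compl] with ω hω
    simp [obs, withStatus, Y, indicator_of_notMem (show ω ∉ {ω' | U ω' ≤ V ω'} from hω)]
  have e : μ.map (obs U V Z W)
      = (μ.restrict Sᶜ).map (obs U V Z W) + (μ.restrict S).map (obs U V Z W) := by
    rw [← Measure.map_add _ _ (measurable_obs hU hV hZ hW), add_comm,
      Measure.restrict_add_restrict_compl hSm]
  rw [e, domMeasure_eq, withDensity_add_measure,
    withDensity_map_eq (measurable_withStatus 0) (hpm 0 (Or.inl rfl)),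
    withDensity_map_eq (measurable_withStatus 1) (hpm 1 (Or.inr rfl)), e0, e1, one, zero]
  congr 3
  · ext y
    simp [bernoulliDens, withStatus, theta]
  · ext y
    simp [bernoulliDens, withStatus, theta]

theorem ae_domMeasure_mem_obsRange (hV : Measurable V) (hZ : Measurable Z) (hW : Measurable W)
    (hdata : DataAssumptions μ U V Z W a b l u F β h H) :
    ∃ C, ∀ᵐ x ∂(domMeasure (μ.map fun ω => (V ω, Z ω, W ω))), x ∈ obsRange d a b l u C := by
  obtain ⟨C, hC⟩ := ae_obs_mem_obsRange hV hW hdata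
  refine ⟨C, ?_⟩
  rw [domMeasure_eq, ae_add_measure_iff]
  exact ⟨ae_map_withStatus hV hZ hW hC (Or.inl rfl),
    ae_map_withStatus hV hZ hW hC (Or.inr rfl)⟩

end Law

/-! ### Root densities and their derivatives -/

section Derivatives

variable {X : Type*} [MeasurableSpace X] {D : Measure X}

/-- If the increments `R t` converge in `L₂` to `S` and agree up to a remainder of order `t (R t)²`
with functions `T t` orthogonal to `k`, then `S` is orthogonal to `k`. -/
theorem integral_mul_eq_zero_of_quadratic_remainder [IsFiniteMeasure D] {S k : X → ℝ}
    (hS : MemLp S 2 D) (hk : MemLp k ∞ D) {R T : ℝ → X → ℝ} {C : ℝ} (hC : 0 ≤ C)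
    (hR : Tendsto (fun t => ∫⁻ x, ENNReal.ofReal ((R t x - S x) ^ 2) ∂D) (𝓝[>] 0) (𝓝 0))
    (hRm : ∀ᶠ t in 𝓝[>] (0 : ℝ), AEMeasurable (R t) D)
    (hT : ∀ᶠ t in 𝓝[>] (0 : ℝ), MemLp (T t) ∞ D ∧
      (∀ᵐ x ∂D, |R t x - T t x| ≤ C * t * R t x ^ 2) ∧ ∫ x, k x * T t x ∂D = 0) :
    ∫ x, k x * S x ∂D = 0 := by
  obtain ⟨B, hB, hkB⟩ := exists_bound_of_memLp_top hk
  have hS1 : Integrable S D := hS.integrable one_le_two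
  have hS2 : Integrable (fun x => S x ^ 2) D := hS.integrable_sq
  set E : ℝ → ℝ := fun t => (∫⁻ x, ENNReal.ofReal ((R t x - S x) ^ 2) ∂D).toReal with hE
  have hElim : Tendsto E (𝓝[>] 0) (𝓝 0) := by
    have : Tendsto E (𝓝[>] 0) (𝓝 (0 : ℝ≥0∞).toReal) :=
      (ENNReal.tendsto_toReal ENNReal.zero_ne_top).comp hR
    simpa using this
  -- Only `L₁` control of `R t - S` is needed. The inequality `|x| ≤ ε + x² / ε` extracts it from
  -- `L₂` convergence; `t → 0` comes first, then `ε → 0`.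
  have hbound : ∀ ε > 0, |∫ x, k x * S x ∂D| ≤ B * (ε * D.real univ) := fun ε hε => by
    have hlim : Tendsto (fun t => B * (ε * D.real univ + E t / ε
        + 2 * C * t * (E t + ∫ x, S x ^ 2 ∂D))) (𝓝[>] 0)
        (𝓝 (B * (ε * D.real univ + 0 / ε + 2 * C * 0 * (0 + ∫ x, S x ^ 2 ∂D)))) := by
      have ht : Tendsto (fun t : ℝ => t) (𝓝[>] 0) (𝓝 0) := nhdsWithin_le_nhds
      exact ((tendsto_const_nhds.add (hElim.div_const ε)).add
        ((ht.const_mul (2 * C)).mul (hElim.add_const _))).const_mul B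
    have e : B * (ε * D.real univ + 0 / ε + 2 * C * 0 * (0 + ∫ x, S x ^ 2 ∂D))
        = B * (ε * D.real univ) := by simp
    rw [e] at hlim
    refine ge_of_tendsto hlim ?_
    filter_upwards [hRm, hT, self_mem_nhdsWithin, hR.eventually (gt_mem_nhds one_pos)] with t
      hRt ⟨hTt, hdiff, hTk⟩ ht hfin
    have ht : 0 < t := ht
    have hRS : Integrable (fun x => (R t x - S x) ^ 2) D := by
      refine ⟨((hRt.sub hS.1.aemeasurable).pow_const 2).aestronglyMeasurable, ?_⟩
      rw [hasFiniteIntegral_iff_ofReal (ae_of_all _ fun x => sq_nonneg _)]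
      exact hfin.trans ENNReal.one_lt_top
    have hEt : E t = ∫ x, (R t x - S x) ^ 2 ∂D := by
      rw [integral_eq_lintegral_of_nonneg_ae (ae_of_all _ fun x => sq_nonneg _) hRS.1]
    have hkS : Integrable (fun x => k x * S x) D := by
      refine hS1.bdd_mul hk.1 (c := B) hkB
    have hkT : Integrable (fun x => k x * T t x) D := (memLp_top_mul hk hTt).integrable le_top
    have h1 : ∫ x, k x * S x ∂D = ∫ x, (k x * S x - k x * T t x) ∂D := by
      rw [integral_sub hkS hkT, hTk, sub_zero]
    have i1 : Integrable (fun x => ε + (R t x - S x) ^ 2 / ε) D :=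
      (integrable_const ε).add (hRS.div_const ε)
    have i2 : Integrable (fun x => (R t x - S x) ^ 2 + S x ^ 2) D := hRS.add hS2
    have hmaj : Integrable (fun x => B * (ε + (R t x - S x) ^ 2 / ε
        + 2 * C * t * ((R t x - S x) ^ 2 + S x ^ 2))) D :=
      (i1.add (i2.const_mul (2 * C * t))).const_mul B
    have h2 : |∫ x, k x * S x ∂D| ≤ ∫ x, B * (ε + (R t x - S x) ^ 2 / ε
        + 2 * C * t * ((R t x - S x) ^ 2 + S x ^ 2)) ∂D := by
      rw [h1, ← Real.norm_eq_abs]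
      refine norm_integral_le_of_norm_le hmaj ?_
      filter_upwards [hkB, hdiff] with x hkx hx
      have a1 : |R t x - S x| ≤ ε + (R t x - S x) ^ 2 / ε := by
        have : |R t x - S x| * ε ≤ ε * ε + (R t x - S x) ^ 2 := by
          rw [← sq_abs (R t x - S x)]
          nlinarith [sq_nonneg (|R t x - S x| - ε), sq_nonneg (|R t x - S x| + ε)]
        calc |R t x - S x| = |R t x - S x| * ε / ε := by field_simp
          _ ≤ (ε * ε + (R t x - S x) ^ 2) / ε := by gcongr
          _ = ε + (R t x - S x) ^ 2 / ε := by field_simp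
      have a2 : R t x ^ 2 ≤ 2 * ((R t x - S x) ^ 2 + S x ^ 2) := by
        nlinarith [sq_nonneg (R t x - 2 * S x)]
      have a3 : |S x - T t x| ≤ |R t x - S x| + |R t x - T t x| := by
        rw [abs_sub_comm (R t x) (S x)]
        exact abs_sub_le _ _ _
      have a4 : C * t * R t x ^ 2 ≤ C * t * (2 * ((R t x - S x) ^ 2 + S x ^ 2)) := by gcongr
      rw [Real.norm_eq_abs, ← mul_sub, abs_mul]
      refine mul_le_mul hkx ?_ (abs_nonneg _) hB
      linarith
    refine h2.trans (le_of_eq ?_)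
    rw [integral_const_mul, integral_add i1 (i2.const_mul (2 * C * t)), integral_add (integrable_const ε)
      (hRS.div_const ε), integral_const_mul, integral_add hRS hS2, integral_div, hEt]
    simp [mul_comm]
  have : Tendsto (fun ε : ℝ => B * (ε * D.real univ)) (𝓝[>] 0) (𝓝 (B * (0 * D.real univ))) := by
    have ht : Tendsto (fun t : ℝ => t) (𝓝[>] 0) (𝓝 0) := nhdsWithin_le_nhds
    exact (ht.mul_const _).const_mul B
  have h0 := ge_of_tendsto this (Filter.eventually_of_mem self_mem_nhdsWithin hbound)
  simpa using h0

end Derivatives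

/-! ### Quadratic mean differentiability and orthogonality to arbitrary nuisance scores -/

section Model

variable {d : ℕ} {a b l u C : ℝ} {D : Measure (Obs d)} {F f f' : ℝ → ℝ}
  {β : EuclideanSpace ℝ (Fin d)} {h H : ℝ → ℝ}

/-- Differentiability in quadratic mean of one-sided linear perturbations of the predictor. -/
theorem tendsto_root_density_path [IsFiniteMeasure D] (hF : ErrorDistribution F f f')
    (hD : ∀ᵐ x ∂D, x ∈ obsRange d a b l u C) (hϑ : MemLp (theta β h H) ∞ D) {ζ g : Obs d → ℝ}
    (hζ : MemLp ζ ∞ D) (hg : ∀ᵐ x ∂D, g x = ζ x * Qfun F f β h H x) :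
    Tendsto (fun t : ℝ => ∫⁻ x, ENNReal.ofReal
      (((√(bernoulliDens F x.2.1 (theta β h H x + t * ζ x))
        - √(bernoulliDens F x.2.1 (theta β h H x))) / t
        - (1 / 2) * g x * √(bernoulliDens F x.2.1 (theta β h H x))) ^ 2) ∂D)
      (𝓝[>] 0) (𝓝 0) := by
  obtain ⟨R, -, hR⟩ := exists_bound_of_memLp_top hϑ
  obtain ⟨K, hK, hζK⟩ := exists_bound_of_memLp_top hζ
  obtain ⟨B, hB, hBT⟩ := hF.exists_taylor_le R K
  -- The Taylor remainder is at most `B (t ζ)²`; divided by `t` it is at most `B K² t`, uniformly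
  -- over the range of the data.
  have hlim : Tendsto (fun t : ℝ => ENNReal.ofReal ((B * K ^ 2 * t) ^ 2) * D univ) (𝓝[>] 0)
      (𝓝 (ENNReal.ofReal ((B * K ^ 2 * 0) ^ 2) * D univ)) := by
    have ht : Tendsto (fun t : ℝ => t) (𝓝[>] 0) (𝓝 0) := nhdsWithin_le_nhds
    exact ENNReal.Tendsto.mul_const (ENNReal.tendsto_ofReal ((ht.const_mul _).pow 2))
      (Or.inr (measure_ne_top _ _))
  rw [mul_zero, zero_pow two_ne_zero, ENNReal.ofReal_zero, zero_mul] at hlim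
  refine tendsto_of_tendsto_of_tendsto_of_le_of_le' tendsto_const_nhds hlim
    (Eventually.of_forall fun _ => zero_le) ?_
  filter_upwards [Ioo_mem_nhdsGT (zero_lt_one (α := ℝ))] with t ht
  rw [← lintegral_const]
  refine lintegral_mono_ae ?_
  filter_upwards [hD, hR, hζK, hg] with x hx hRx hζx hgx
  refine ENNReal.ofReal_le_ofReal (sq_le_sq.2 ?_)
  have hb : |t * ζ x| ≤ K := by
    rw [abs_mul, abs_of_pos ht.1]
    nlinarith [ht.1, ht.2, abs_nonneg (ζ x)]
  have h1 := hBT x.2.1 (theta β h H x) (t * ζ x) hx.2.1 hRx hb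
  have e : (√(bernoulliDens F x.2.1 (theta β h H x + t * ζ x))
      - √(bernoulliDens F x.2.1 (theta β h H x))) / t
      - (1 / 2) * g x * √(bernoulliDens F x.2.1 (theta β h H x))
      = (√(bernoulliDens F x.2.1 (theta β h H x + t * ζ x))
      - √(bernoulliDens F x.2.1 (theta β h H x)) - 1 / 2 *
        (t * ζ x * bernoulliScore F f x.2.1 (theta β h H x))
        * √(bernoulliDens F x.2.1 (theta β h H x))) / t := by
    have : Qfun F f β h H x = bernoulliScore F f x.2.1 (theta β h H x) := rfl
    have ht0 := ht.1.ne'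
    rw [hgx, this]; field_simp
  have h2 : B * (t * ζ x) ^ 2 / t ≤ B * K ^ 2 * t := by
    rw [div_le_iff₀ ht.1, mul_pow]
    have : ζ x ^ 2 ≤ K ^ 2 := sq_le_sq' (by linarith [(abs_le.1 hζx).1]) (abs_le.1 hζx).2
    have := mul_le_mul_of_nonneg_left this (mul_nonneg hB (sq_nonneg t))
    linarith
  rw [e, abs_div, abs_of_pos ht.1]
  exact (div_le_div_of_nonneg_right h1 ht.1.le).trans (h2.trans (le_abs_self _))

/-- Differentiability in quadratic mean in the regression parameter. -/
theorem tendsto_root_density_regression [IsFiniteMeasure D] (hF : ErrorDistribution F f f')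
    (hD : ∀ᵐ x ∂D, x ∈ obsRange d a b l u C) (hϑ : MemLp (theta β h H) ∞ D)
    {s : Fin d → Obs d → ℝ}
    (hs : ∀ i, ∀ᵐ x ∂D, s i x = x.2.2.1 i * Qfun F f β h H x) :
    Tendsto (fun c : EuclideanSpace ℝ (Fin d) => (∫⁻ x, ENNReal.ofReal
      ((√(bernoulliDens F x.2.1 (theta (β + c) h H x))
        - √(bernoulliDens F x.2.1 (theta β h H x))
        - (1 / 2) * (∑ i, c i * s i x) * √(bernoulliDens F x.2.1 (theta β h H x))) ^ 2) ∂D)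
      / ENNReal.ofReal (‖c‖ ^ 2)) (𝓝[≠] 0) (𝓝 0) := by
  obtain ⟨R, -, hR⟩ := exists_bound_of_memLp_top hϑ
  obtain ⟨B, hB, hBT⟩ := hF.exists_taylor_le R |C|
  have hlim : Tendsto (fun c : EuclideanSpace ℝ (Fin d) =>
      ENNReal.ofReal ((B * C ^ 2 * ‖c‖) ^ 2) * D univ) (𝓝[≠] 0)
      (𝓝 (ENNReal.ofReal ((B * C ^ 2 * ‖(0 : EuclideanSpace ℝ (Fin d))‖) ^ 2) * D univ)) := by
    have ht : Tendsto (fun c : EuclideanSpace ℝ (Fin d) => ‖c‖) (𝓝[≠] 0)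
        (𝓝 ‖(0 : EuclideanSpace ℝ (Fin d))‖) := (continuous_norm.tendsto 0).mono_left
          nhdsWithin_le_nhds
    exact ENNReal.Tendsto.mul_const (ENNReal.tendsto_ofReal ((ht.const_mul _).pow 2))
      (Or.inr (measure_ne_top _ _))
  rw [norm_zero, mul_zero, zero_pow two_ne_zero, ENNReal.ofReal_zero, zero_mul] at hlim
  refine tendsto_of_tendsto_of_tendsto_of_le_of_le' tendsto_const_nhds hlim
    (Eventually.of_forall fun _ => zero_le) ?_
  have hball : ∀ᶠ c : EuclideanSpace ℝ (Fin d) in 𝓝[≠] 0, ‖c‖ ≤ 1 := by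
    filter_upwards [mem_nhdsWithin_of_mem_nhds (Metric.closedBall_mem_nhds
      (0 : EuclideanSpace ℝ (Fin d)) one_pos)] with c hc
    simpa using hc
  filter_upwards [hball] with c hc
  refine ENNReal.div_le_of_le_mul ?_
  rw [mul_right_comm, ← ENNReal.ofReal_mul (sq_nonneg _), ← mul_pow, ← lintegral_const]
  refine lintegral_mono_ae ?_
  filter_upwards [hD, hR, ae_all_iff.2 hs] with x hx hRx hsx
  refine ENNReal.ofReal_le_ofReal (sq_le_sq.2 ?_)
  have hin : |inner ℝ c x.2.2.1| ≤ ‖c‖ * C :=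
    (abs_real_inner_le_norm _ _).trans (mul_le_mul_of_nonneg_left hx.2.2.1 (norm_nonneg _))
  have hC : 0 ≤ C := (norm_nonneg _).trans hx.2.2.1
  have hb : |inner ℝ c x.2.2.1| ≤ |C| := by
    rw [abs_of_nonneg hC]; nlinarith [norm_nonneg c]
  have h1 := hBT x.2.1 (theta β h H x) (inner ℝ c x.2.2.1) hx.2.1 hRx hb
  have e1 : theta (β + c) h H x = theta β h H x + inner ℝ c x.2.2.1 := by
    simp only [theta, inner_add_left]; ring
  have e2 : ∑ i, c i * s i x
      = inner ℝ c x.2.2.1 * bernoulliScore F f x.2.1 (theta β h H x) := by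
    simp only [PiLp.inner_apply, hsx, Finset.sum_mul]
    refine Finset.sum_congr rfl fun i _ => ?_
    have : Qfun F f β h H x = bernoulliScore F f x.2.1 (theta β h H x) := rfl
    simp [this]; ring
  rw [e1, e2]
  refine h1.trans ?_
  rw [abs_of_nonneg (by positivity)]
  have := pow_le_pow_left₀ (abs_nonneg _) hin 2
  rw [sq_abs] at this
  calc B * inner ℝ c x.2.2.1 ^ 2 ≤ B * (‖c‖ * C) ^ 2 := by gcongr
    _ = B * C ^ 2 * ‖c‖ * ‖c‖ := by ring

/-- The law with density `bernoulliDens` with respect to `D`. -/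
theorem absolutelyContinuous_withDensity_bernoulliDens (hF : ErrorDistribution F f f')
    (hD : ∀ᵐ x ∂D, x ∈ obsRange d a b l u C) (hϑ : MemLp (theta β h H) ∞ D) :
    D ≪ D.withDensity fun x => ENNReal.ofReal (bernoulliDens F x.2.1 (theta β h H x)) := by
  refine withDensity_absolutelyContinuous'
    (aemeasurable_bernoulliDens hF hϑ.1.aemeasurable).ennreal_ofReal ?_
  filter_upwards [hD] with x hx
  simpa using hF.bernoulliDens_pos hx.2.1 _

theorem integral_withDensity_bernoulliDens (hF : ErrorDistribution F f f')
    (hD : ∀ᵐ x ∂D, x ∈ obsRange d a b l u C) (hϑ : MemLp (theta β h H) ∞ D) (k : Obs d → ℝ) :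
    ∫ x, k x ∂(D.withDensity fun x => ENNReal.ofReal (bernoulliDens F x.2.1 (theta β h H x)))
      = ∫ x, bernoulliDens F x.2.1 (theta β h H x) * k x ∂D := by
  rw [integral_withDensity_eq_integral_toReal_smul₀
    (aemeasurable_bernoulliDens hF hϑ.1.aemeasurable).ennreal_ofReal
    (ae_of_all _ fun _ => ENNReal.ofReal_lt_top)]
  refine integral_congr_ae ?_
  filter_upwards [hD] with x hx
  rw [ENNReal.toReal_ofReal (hF.bernoulliDens_pos hx.2.1 _).le, smul_eq_mul]

/-- A bounded `k` for which `k Q` is orthogonal to the functions of `w` in the centred class and to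
the monotone functions of `v` is orthogonal to all nuisance scores. -/
theorem integral_mul_nuisance_score_eq_zero [IsFiniteMeasure D] (hF : ErrorDistribution F f f')
    {ν : ℕ} (hν : 0 < ν) (hab : a ≤ b) {PW : Measure ℝ} [IsFiniteMeasure PW]
    (hPW : ∀ᵐ w ∂PW, w ∈ Icc a b) {c₀ : ℝ}
    (hD : ∀ᵐ x ∂D, x ∈ obsRange d a b l u C)
    (hh : MemSobolevCentredBdd ν a b PW c₀ h) (hH : Monotone H) {P : Measure (Obs d)}
    (hP : P = D.withDensity fun x => ENNReal.ofReal (bernoulliDens F x.2.1 (theta β h H x)))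
    {k : Obs d → ℝ} (hk : MemLp k ∞ D)
    (hkW : ∀ r, MemSobolevCentred ν a b PW r →
      ∫ x, k x * Qfun F f β h H x * r x.2.2.2 ∂P = 0)
    (hkV : ∀ r, Monotone r → ∫ x, k x * Qfun F f β h H x * r x.1 ∂P = 0)
    {η : ℝ → (ℝ → ℝ) × (ℝ → ℝ)}
    (hη : ∀ᶠ t in 𝓝[>] (0 : ℝ), MemSobolevCentredBdd ν a b PW c₀ (η t).1 ∧ Monotone (η t).2)
    {g : Obs d → ℝ} (hg : MemLp g 2 P)
    (hdqm : Tendsto (fun t : ℝ => ∫⁻ x, ENNReal.ofReal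
      (((√(bernoulliDens F x.2.1 (theta β (η t).1 (η t).2 x))
        - √(bernoulliDens F x.2.1 (theta β h H x))) / t
        - (1 / 2) * g x * √(bernoulliDens F x.2.1 (theta β h H x))) ^ 2) ∂D)
      (𝓝[>] 0) (𝓝 0)) :
    ∫ x, k x * g x ∂P = 0 := by
  have hϑ : MemLp (theta β h H) ∞ D := memLp_top_theta hD (hh.1.1.continuousOn hν hab) hH
  set p : Obs d → ℝ := fun x => bernoulliDens F x.2.1 (theta β h H x) with hp
  have hpm : AEMeasurable p D := aemeasurable_bernoulliDens hF hϑ.1.aemeasurable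
  have hp0 : ∀ᵐ x ∂D, 0 < p x := hD.mono fun x hx => hF.bernoulliDens_pos hx.2.1 _
  have hp1 : ∀ᵐ x ∂D, p x ≤ 1 := hD.mono fun x hx => hF.bernoulliDens_le_one hx.2.1 _
  have hs : MemLp (fun x => √(p x)) ∞ D := by
    refine memLp_top_of_bound hpm.sqrt.aestronglyMeasurable 1 ?_
    filter_upwards [hp1] with x hx
    rw [Real.norm_eq_abs, abs_of_nonneg (Real.sqrt_nonneg _)]
    exact Real.sqrt_le_one.2 hx
  have hQ : MemLp (Qfun F f β h H) ∞ D := memLp_top_Qfun hF hD hϑ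
  have hPint : ∀ q : Obs d → ℝ, ∫ x, q x ∂P = ∫ x, p x * q x ∂D := fun q => by
    rw [hP]; exact integral_withDensity_bernoulliDens hF hD hϑ q
  -- The integral of the square over `D` is a quarter of the integral of `g²` over `P`.
  have hS : MemLp (fun x => 1 / 2 * g x * √(p x)) 2 D := by
    have hgm : AEStronglyMeasurable g D := hg.1.mono_ac (by
      rw [hP]; exact absolutelyContinuous_withDensity_bernoulliDens hF hD hϑ)
    refine (memLp_two_iff_integrable_sq ((hgm.const_mul _).mul hs.1)).2 ?_
    have h1 := hg.integrable_sq
    rw [hP, integrable_withDensity_iff_integrable_smul₀' hpm.ennreal_ofReal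
      (ae_of_all _ fun _ => ENNReal.ofReal_lt_top)] at h1
    refine (h1.const_mul (1 / 4)).congr ?_
    filter_upwards [hp0] with x hx
    rw [ENNReal.toReal_ofReal hx.le, smul_eq_mul, Pi.mul_apply, mul_pow, Real.sq_sqrt hx.le]
    ring
  obtain ⟨R, -, hR⟩ := exists_bound_of_memLp_top hϑ
  set BH := max |H l| |H u|
  -- If truncation at `±M` acts, then `|(η t).2 v| ≥ M`. As `h` and `(η t).1` contribute at most `2
  -- |c₀|` and `H` at most `BH`, the untruncated increment is then at least `1` in absolute value.
  set M := BH + 2 * |c₀| + 1 with hM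
  have hBH : ∀ v ∈ Icc l u, |H v| ≤ BH := fun v hv => abs_le_max_abs_abs (hH hv.1) (hH hv.2)
  have hBH0 : 0 ≤ BH := le_max_of_le_left (abs_nonneg _)
  have hM0 : 0 < M := by positivity
  have hhb : ∀ {r : ℝ → ℝ}, MemSobolevCentredBdd ν a b PW c₀ r → ∀ w ∈ Icc a b, |r w| ≤ |c₀| :=
    fun hr w hw => by
      obtain ⟨c', hc', hb⟩ := hr.2
      exact (hb w hw).trans (hc'.le.trans (le_abs_self _))
  obtain ⟨B, hB, hBT⟩ := hF.exists_truncated_le R (2 * |c₀| + M + BH)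
  -- the truncated increment of the predictor
  let τ : ℝ → ℝ → ℝ := fun t v => max (-M) (min M ((η t).2 v))
  let ζ : ℝ → Obs d → ℝ := fun t x => ((η t).1 x.2.2.2 + (-1) * h x.2.2.2) + (τ t x.1 - H x.1)
  have hτ : ∀ t, Monotone (η t).2 → Monotone (τ t) := fun t ht =>
    monotone_const.max (monotone_const.min ht)
  -- The truncated increment is a centred function of `w` plus a difference of two monotone
  -- functions of `v`, so three applications of the orthogonality hypotheses suffice.
  have hζm : ∀ t, MemSobolevCentredBdd ν a b PW c₀ (η t).1 → Monotone (η t).2 →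
      MemLp (ζ t) ∞ D ∧ ∫ x, k x * Qfun F f β h H x * ζ t x ∂P = 0 := fun t h1 h2 => by
    have c1 := h1.1.add_const_mul hν hab hPW hh.1 (-1)
    have m1 : MemLp (fun x : Obs d => (η t).1 x.2.2.2 + (-1) * h x.2.2.2) ∞ D :=
      memLp_top_comp_continuousOn (h := fun w => (η t).1 w + (-1) * h w)
        (c1.1.continuousOn hν hab) (by fun_prop) (hD.mono fun x hx => hx.2.2.2)
    have m2 : MemLp (fun x : Obs d => τ t x.1) ∞ D :=
      memLp_top_comp_monotone (hτ t h2) (by fun_prop) (hD.mono fun x hx => hx.1)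
    have m3 : MemLp (fun x : Obs d => H x.1) ∞ D :=
      memLp_top_comp_monotone hH (by fun_prop) (hD.mono fun x hx => hx.1)
    refine ⟨m1.add (m2.sub m3), ?_⟩
    have hpp : MemLp p ∞ D := by
      refine memLp_top_of_bound hpm.aestronglyMeasurable 1 ?_
      filter_upwards [hp0, hp1] with x hx hx'
      rwa [Real.norm_eq_abs, abs_of_pos hx]
    have int : ∀ q : Obs d → ℝ, MemLp q ∞ D →
        Integrable (fun x => p x * (k x * Qfun F f β h H x * q x)) D := fun q hq =>
      (memLp_top_mul hpp (memLp_top_mul (memLp_top_mul hk hQ) hq)).integrable le_top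
    have z1 := hkW _ c1
    have z2 := hkV _ (hτ t h2)
    have z3 := hkV _ hH
    rw [hPint] at z1 z2 z3 ⊢
    have e : (fun x => p x * (k x * Qfun F f β h H x * ζ t x))
        = fun x => p x * (k x * Qfun F f β h H x * ((η t).1 x.2.2.2 + (-1) * h x.2.2.2))
          + (p x * (k x * Qfun F f β h H x * τ t x.1)
            - p x * (k x * Qfun F f β h H x * H x.1)) := by
      ext x; simp only [ζ]; ring
    have i23 : Integrable (fun x => p x * (k x * Qfun F f β h H x * τ t x.1)
        - p x * (k x * Qfun F f β h H x * H x.1)) D := (int _ m2).sub (int _ m3)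
    rw [e, integral_add (int _ m1) i23, integral_sub (int _ m2) (int _ m3),
      z1, z2, z3]
    simp
  -- With `R t` the difference quotient of the root density, the increment is `t * R t`; the
  -- remainder `B (t * R t)²` divided by `t` is `B * t * (R t)²`. One factor `√p` in each of `k √p`
  -- and `S` recovers integration against `P`.
  have main := integral_mul_eq_zero_of_quadratic_remainder (D := D)
    (S := fun x => 1 / 2 * g x * √(p x)) (k := fun x => k x * √(p x))
    (R := fun t x => (√(bernoulliDens F x.2.1 (theta β (η t).1 (η t).2 x)) - √(p x)) / t)
    (T := fun t x => 1 / 2 * (t⁻¹ * ζ t x * Qfun F f β h H x) * √(p x))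
    hS (memLp_top_mul hk hs) hB hdqm ?_ ?_
  · rw [hPint]
    have e : ∫ x, k x * √(p x) * (1 / 2 * g x * √(p x)) ∂D = 1 / 2 * ∫ x, p x * (k x * g x) ∂D := by
      rw [← integral_const_mul]
      refine integral_congr_ae ?_
      filter_upwards [hp0] with x hx
      calc k x * √(p x) * (1 / 2 * g x * √(p x)) = 1 / 2 * ((√(p x) * √(p x)) * (k x * g x)) := by
            ring
        _ = _ := by rw [Real.mul_self_sqrt hx.le]
    rw [e] at main
    linarith
  · filter_upwards [hη] with t ht
    have h1 : MemLp (theta β (η t).1 (η t).2) ∞ D :=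
      memLp_top_theta hD (ht.1.1.1.continuousOn hν hab) ht.2
    exact ((aemeasurable_bernoulliDens hF h1.1.aemeasurable).sqrt.sub hpm.sqrt).div_const t
  · filter_upwards [hη, self_mem_nhdsWithin] with t ⟨h1, h2⟩ (ht : 0 < t)
    obtain ⟨m, z⟩ := hζm t h1 h2
    refine ⟨memLp_top_mul ((memLp_top_mul (m.const_mul _) hQ).const_mul _) hs, ?_, ?_⟩
    · filter_upwards [hD, hR] with x hx hRx
      have b1 := abs_le.1 (hhb h1 _ hx.2.2.2)
      have b2 := abs_le.1 (hhb hh _ hx.2.2.2)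
      have b3 := abs_le.1 (hBH _ hx.1)
      have hτ1 : -M ≤ τ t x.1 := le_max_left _ _
      have hτ2 : τ t x.1 ≤ M := max_le (by linarith) (min_le_left _ _)
      have hζb : |ζ t x| ≤ 2 * |c₀| + M + BH := by
        simp only [ζ]; rw [abs_le]; constructor <;> linarith
      set δη := ((η t).1 x.2.2.2 - h x.2.2.2) + ((η t).2 x.1 - H x.1) with hδη
      have hcase : δη = ζ t x ∨ 1 ≤ |δη| := by
        rcases le_total ((η t).2 x.1) (-M) with h3 | h3
        · right; refine le_trans ?_ (neg_le_abs _); simp only [δη]; linarith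
        rcases le_total M ((η t).2 x.1) with h4 | h4
        · right; refine le_trans ?_ (le_abs_self _); simp only [δη]; linarith
        · left; simp only [δη, ζ, τ]; rw [min_eq_right h4, max_eq_right h3]; ring
      have key := hBT x.2.1 (theta β h H x) δη (ζ t x) hx.2.1 hRx hζb hcase
      have e : theta β h H x + δη = theta β (η t).1 (η t).2 x := by
        simp only [theta, δη]; ring
      rw [e] at key
      have e2 : (√(bernoulliDens F x.2.1 (theta β (η t).1 (η t).2 x)) - √(p x)) / t
          - 1 / 2 * (t⁻¹ * ζ t x * Qfun F f β h H x) * √(p x)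
          = (√(bernoulliDens F x.2.1 (theta β (η t).1 (η t).2 x))
            - √(bernoulliDens F x.2.1 (theta β h H x))
            - 1 / 2 * (ζ t x * bernoulliScore F f x.2.1 (theta β h H x))
              * √(bernoulliDens F x.2.1 (theta β h H x))) / t := by
        have : Qfun F f β h H x = bernoulliScore F f x.2.1 (theta β h H x) := rfl
        simp only [hp]
        rw [this]; field_simp
      rw [e2, abs_div, abs_of_pos ht, div_le_iff₀ ht]
      refine key.trans (le_of_eq ?_)
      simp only [hp]
      field_simp
    · rw [hPint] at z
      rw [← mul_zero (1 / 2 * t⁻¹), ← z, ← integral_const_mul]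
      refine integral_congr_ae ?_
      filter_upwards [hp0] with x hx
      calc k x * √(p x) * (1 / 2 * (t⁻¹ * ζ t x * Qfun F f β h H x) * √(p x))
          = 1 / 2 * t⁻¹ * ((√(p x) * √(p x)) * (k x * Qfun F f β h H x * ζ t x)) := by ring
        _ = _ := by rw [Real.mul_self_sqrt hx.le]

end Model

/-- A function that is Lipschitz on an interval is there the difference of two monotone
functions. -/
theorem exists_monotone_sub_eq {q : ℝ → ℝ} {l u C : ℝ} (hlu : l ≤ u)
    (hq : ∀ v ∈ Icc l u, ∀ w ∈ Icc l u, |q v - q w| ≤ C * |v - w|) :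
    ∃ r₁ r₂ : ℝ → ℝ, Monotone r₁ ∧ Monotone r₂ ∧ ∀ v ∈ Icc l u, q v = r₁ v - r₂ v := by
  -- Projecting onto `[l, u]` makes both functions monotone on the whole line; the added slope `|C|`
  -- dominates the variation of `q`.
  let p : ℝ → ℝ := fun v => max l (min u v)
  have hp : ∀ v, p v ∈ Icc l u := fun v => ⟨le_max_left _ _, max_le hlu (min_le_left _ _)⟩
  have hpm : Monotone p := monotone_const.max (monotone_const.min monotone_id)
  refine ⟨fun v => q (p v) + |C| * p v, fun v => |C| * p v, fun v w hvw => ?_,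
    hpm.const_mul (abs_nonneg C), fun v hv => ?_⟩
  · have h1 := hpm hvw
    have h2 := hq _ (hp v) _ (hp w)
    rw [abs_sub_comm (p v), abs_of_nonneg (sub_nonneg.2 h1)] at h2
    have h3 := (abs_le.1 h2).2
    have h4 := mul_le_mul_of_nonneg_right (le_abs_self C) (sub_nonneg.2 h1)
    simp only
    linarith
  · have : p v = v := by
      simp only [p]; rw [min_eq_right hv.2, max_eq_right hv.1]
    simp [this]

/-! ### Nuisance scores of linear paths -/

section Tangent

variable {d : ℕ} {a b l u C c₀ : ℝ} {ν : ℕ} {F f f' : ℝ → ℝ} {β : EuclideanSpace ℝ (Fin d)}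
  {h H : ℝ → ℝ} {B₀ : Set (EuclideanSpace ℝ (Fin d))}
  {G : Measure (ℝ × EuclideanSpace ℝ (Fin d) × ℝ)} [IsFiniteMeasure G]

/-- Centred functions of `w` and monotone functions of `v` give nuisance scores. -/
theorem mem_nuisanceTangentSet (hF : ErrorDistribution F f f') (hν : 0 < ν) (hab : a ≤ b)
    (hPW : ∀ᵐ w ∂(G.map fun y => y.2.2), w ∈ Icc a b)
    (hD : ∀ᵐ x ∂(domMeasure G), x ∈ obsRange d a b l u C) (hβ : β ∈ B₀)
    (hh : MemSobolevCentredBdd ν a b (G.map fun y => y.2.2) c₀ h) (hH : Monotone H)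
    {k r : ℝ → ℝ} (hk : MemSobolevCentred ν a b (G.map fun y => y.2.2) k) (hr : Monotone r)
    {g : Lp ℝ 2 ((transformationModel F G B₀ ν a b c₀).law β (h, H))}
    (hg : ∀ᵐ x ∂(transformationModel F G B₀ ν a b c₀).law β (h, H),
      g x = (k x.2.2.2 + r x.1) * Qfun F f β h H x) :
    g ∈ (transformationModel F G B₀ ν a b c₀).nuisanceTangentSet β (h, H) := by
  have hϑ : MemLp (theta β h H) ∞ (domMeasure G) :=
    memLp_top_theta hD (hh.1.1.continuousOn hν hab) hH
  refine ⟨fun t => (fun w => h w + t * k w, fun v => H v + t * r v), by simp, ?_, ?_⟩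
  · obtain ⟨c', hc', hb⟩ := hh.2
    obtain ⟨B, hB⟩ := (isCompact_Icc (a := a) (b := b)).exists_bound_of_continuousOn
      (hk.1.continuousOn hν hab)
    -- The bound `c' < c₀` is strict, so for small `t` the perturbed function stays below the
    -- midpoint `(c₀ + c') / 2`. Monotonicity of `H + t r` uses `t ≥ 0`, hence the one-sided paths.
    have hsmall : ∀ᶠ t in 𝓝[≥] (0 : ℝ), t * |B| < (c₀ - c') / 2 := by
      have : Tendsto (fun t : ℝ => t * |B|) (𝓝[≥] 0) (𝓝 (0 * |B|)) :=
        Tendsto.mul_const _ nhdsWithin_le_nhds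
      rw [zero_mul] at this
      exact this.eventually (gt_mem_nhds (by linarith))
    filter_upwards [hsmall, self_mem_nhdsWithin] with t ht (ht0 : 0 ≤ t)
    refine ⟨hβ, ⟨hh.1.add_const_mul hν hab hPW hk t, (c₀ + c') / 2, by linarith, fun w hw => ?_⟩,
      hH.add (hr.const_mul ht0)⟩
    refine (abs_add_le _ _).trans ?_
    rw [abs_mul, abs_of_nonneg ht0]
    have h1 := hb w hw
    have h2 : |k w| ≤ |B| := (hB w hw).trans (le_abs_self B)
    have h3 := mul_le_mul_of_nonneg_left h2 ht0
    linarith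
  · have hζ : MemLp (fun x : Obs d => k x.2.2.2 + r x.1) ∞ (domMeasure G) :=
      (memLp_top_comp_continuousOn (h := k) (hk.1.continuousOn hν hab) (by fun_prop)
        (hD.mono fun x hx => hx.2.2.2)).add
      (memLp_top_comp_monotone (h := r) hr (by fun_prop) (hD.mono fun x hx => hx.1))
    have key := tendsto_root_density_path hF hD hϑ hζ
      ((absolutelyContinuous_withDensity_bernoulliDens hF hD hϑ).ae_le hg)
    refine key.congr fun t => ?_
    refine lintegral_congr fun x => ?_
    have e : theta β h H x + t * (k x.2.2.2 + r x.1)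
        = theta β (fun w => h w + t * k w) (fun v => H v + t * r v) x := by
      simp only [theta]; ring
    rw [e]
    rfl

end Tangent

/-! ### Normal equations for the least favourable directions -/

section Orthogonality

variable {Ω : Type*} [MeasurableSpace Ω] {μ : Measure Ω} [IsProbabilityMeasure μ] {d : ℕ}
  {U V W : Ω → ℝ} {Z : Ω → EuclideanSpace ℝ (Fin d)} {a b l u C : ℝ} {ν : ℕ} {F f f' : ℝ → ℝ}
  {β : EuclideanSpace ℝ (Fin d)} {h H : ℝ → ℝ} {ht qt : ℝ → EuclideanSpace ℝ (Fin d)}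

/-- The components of `(z - h̃(w) - q̃(v)) Q²` are orthogonal to the centred functions of `w` and to
the monotone functions of `v`. -/
theorem integral_ldot_mul_eq_zero (hF : ErrorDistribution F f f') (hU : Measurable U)
    (hV : Measurable V) (hZ : Measurable Z) (hW : Measurable W) (hν : 0 < ν) (hab : a ≤ b)
    (hP : ∀ᵐ x ∂(μ.map (obs U V Z W)), x ∈ obsRange d a b l u C)
    (hh : ContinuousOn h (Icc a b)) (hH : Monotone H)
    (hlf : IsLeastFavourable μ V Z W ν a b l u
      (fun ω => Qfun F f β h H (obs U V Z W ω)) ht qt) (i : Fin d) :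
    (∀ r, MemSobolevCentred ν a b (μ.map W) r → ∫ x, ldot F f β h H ht qt x i
      * Qfun F f β h H x * r x.2.2.2 ∂(μ.map (obs U V Z W)) = 0) ∧
    ∀ r, Monotone r → ∫ x, ldot F f β h H ht qt x i
      * Qfun F f β h H x * r x.1 ∂(μ.map (obs U V Z W)) = 0 := by
  have hobs := measurable_obs hU hV hZ hW
  set P := μ.map (obs U V Z W) with hPdef
  have pull : ∀ {k : Obs d → ℝ}, MemLp k ∞ P → MemLp (fun ω => k (obs U V Z W ω)) ∞ μ :=
    fun hk => (memLp_map_measure_iff hk.1 hobs.aemeasurable).1 hk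
  have hϑ : MemLp (theta β h H) ∞ P := memLp_top_theta hP hh hH
  have hQ : MemLp (Qfun F f β h H) ∞ P := memLp_top_Qfun hF hP hϑ
  obtain ⟨c, hc, hcQ⟩ := exists_le_sq_Qfun hF hP hϑ
  have hz : MemLp (fun x : Obs d => x.2.2.1 i) ∞ P := memLp_top_covariate hP i
  have hht : MemLp (fun x : Obs d => ht x.2.2.2 i) ∞ P :=
    memLp_top_comp_continuousOn (h := fun w => ht w i) ((hlf.mem i).1.continuousOn hν hab)
      (by fun_prop) (hP.mono fun x hx => hx.2.2.2)
  have hqt : MemLp (fun x : Obs d => qt x.1 i) ∞ P :=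
    memLp_top_comp_continuousOn (h := fun v => qt v i)
      ((EuclideanSpace.proj (𝕜 := ℝ) i).continuous.comp_continuousOn
        hlf.differentiable.continuousOn) (by fun_prop) (hP.mono fun x hx => hx.1)
  have hldot : ∀ x, ldot F f β h H ht qt x i
      = Qfun F f β h H x * (x.2.2.1 i - ht x.2.2.2 i - qt x.1 i) := fun x => by simp [ldot]
  have hQ2 : MemLp (fun x => Qfun F f β h H x ^ 2) ∞ P := by
    simpa only [sq] using memLp_top_mul hQ hQ
  -- Projection on functions of `V` with weight `Q²`, which is bounded and bounded away from zero on
  -- the range of the data.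
  obtain ⟨orthV, orthW⟩ := weighted_residual_orthogonal (μ := μ) (m := sig V) hV.comap_le
    (w := fun ω => Qfun F f β h H (obs U V Z W ω) ^ 2) hc (pull hQ2)
    (ae_of_ae_map hobs.aemeasurable hcQ) (ζ := fun ω => Z ω i) (η := fun ω => ht (W ω) i)
    (q := fun ω => qt (V ω) i) (pull hz) (pull hht) (pull hqt) (hlf.version i)
  have transfer : ∀ {k : Obs d → ℝ}, MemLp k ∞ P →
      ∫ x, ldot F f β h H ht qt x i * Qfun F f β h H x * k x ∂P
      = ∫ ω, (Z ω i - ht (W ω) i - qt (V ω) i) * Qfun F f β h H (obs U V Z W ω) ^ 2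
        * k (obs U V Z W ω) ∂μ := fun {k} hk => by
    have hm : MemLp (fun x => (x.2.2.1 i - ht x.2.2.2 i - qt x.1 i)
        * Qfun F f β h H x ^ 2 * k x) ∞ P :=
      memLp_top_mul (memLp_top_mul ((hz.sub hht).sub hqt) hQ2) hk
    have := integral_map hobs.aemeasurable hm.1
    refine Eq.trans ?_ this
    congr 1; ext x; rw [hldot]; ring
  refine ⟨fun r hr => ?_, fun r hr => ?_⟩
  · have hrm : MemLp (fun x : Obs d => r x.2.2.2) ∞ P :=
      memLp_top_comp_continuousOn (h := r) (hr.1.continuousOn hν hab) (by fun_prop)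
        (hP.mono fun x hx => hx.2.2.2)
    rw [transfer hrm]
    exact orthW _ (pull hrm) (hlf.orthogonal r hr i)
  · have hrm : MemLp (fun x : Obs d => r x.1) ∞ P :=
      memLp_top_comp_monotone hr (by fun_prop) (hP.mono fun x hx => hx.1)
    rw [transfer hrm]
    refine orthV _ ?_ (pull hrm)
    exact (hr.measurable.comp (comap_measurable V)).stronglyMeasurable.aestronglyMeasurable

end Orthogonality

end SemiPar

/-! ### Identification of the projection and of the information matrix -/

theorem theorem5 {Ω : Type*} [MeasurableSpace Ω] (μ : Measure Ω) [IsProbabilityMeasure μ] {d : ℕ}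
    -- the data
    (U V : Ω → ℝ) (Z : Ω → EuclideanSpace ℝ (Fin d)) (W : Ω → ℝ)
    (hU : Measurable U) (hV : Measurable V) (hZ : Measurable Z) (hW : Measurable W)
    -- the known residual distribution function, with its first two derivatives
    (F f f' : ℝ → ℝ) (hF : SemiPar.ErrorDistribution F f f')
    -- the parameter space and the true parameter
    (a b l u c₀ : ℝ) (ν : ℕ) (hν : 0 < ν)
    (B₀ : Set (EuclideanSpace ℝ (Fin d))) (hB₀ : IsOpen B₀) (hB₀' : Bornology.IsBounded B₀)
    (β₀ : EuclideanSpace ℝ (Fin d)) (hβ₀ : β₀ ∈ B₀)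
    (h₀ : ℝ → ℝ) (hh₀ : SemiPar.MemSobolevCentredBdd ν a b (μ.map W) c₀ h₀)
    (H₀ : ℝ → ℝ) (hH₀ : StrictMono H₀)
    (hH₀' : ∀ K : Set ℝ, IsCompact K → Bornology.IsBounded (H₀ '' K))
    -- the distributional assumptions
    (hdata : SemiPar.DataAssumptions μ U V Z W a b l u F β₀ h₀ H₀)
    -- the least favourable directions
    (ht qt : ℝ → EuclideanSpace ℝ (Fin d))
    (hlf : SemiPar.IsLeastFavourable μ V Z W ν a b l u
      (fun ω => SemiPar.Qfun F f β₀ h₀ H₀ (SemiPar.obs U V Z W ω)) ht qt)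
    (hI₀ : (SemiPar.secondMoment μ fun ω =>
      SemiPar.ldot F f β₀ h₀ H₀ ht qt (SemiPar.obs U V Z W ω)).PosDef)
    -- the statistical model for one observation
    (M : SemiPar.Model (SemiPar.Obs d) d ((ℝ → ℝ) × (ℝ → ℝ)))
    (hM : M = SemiPar.transformationModel F (μ.map fun ω => (V ω, Z ω, W ω)) B₀ ν a b c₀) :
    -- the model contains the law of `X = (V, Δ, Z, W)`, at the true parameter
    (β₀, (h₀, H₀)) ∈ M.par ∧ μ.map (SemiPar.obs U V Z W) = M.law β₀ (h₀, H₀) ∧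
    -- the efficient score for `β` and the efficient information matrix for `β`
    M.IsEfficientScore β₀ (h₀, H₀) (SemiPar.ldot F f β₀ h₀ H₀ ht qt) ∧
    M.IsEfficientInformation β₀ (h₀, H₀) (SemiPar.secondMoment μ fun ω =>
      SemiPar.ldot F f β₀ h₀ H₀ ht qt (SemiPar.obs U V Z W ω)) := by
  subst hM
  have hY : Measurable fun ω => (V ω, Z ω, W ω) := hV.prodMk (hZ.prodMk hW)
  have hobs := SemiPar.measurable_obs hU hV hZ hW
  have hab := hdata.a_lt_b.le
  have hH := hH₀.monotone
  have hh := hh₀.1.1.continuousOn hν hab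
  set G := μ.map fun ω => (V ω, Z ω, W ω) with hG
  have hGW : G.map (fun y => y.2.2) = μ.map W := by
    rw [hG, Measure.map_map (by fun_prop) hY]; rfl
  have : IsProbabilityMeasure (μ.map W) := Measure.isProbabilityMeasure_map hW.aemeasurable
  have : IsProbabilityMeasure G := Measure.isProbabilityMeasure_map hY.aemeasurable
  have hPW : ∀ᵐ w ∂(μ.map W), w ∈ Icc a b := by
    rw [← hdata.support_W]; exact Measure.support_mem_ae
  obtain ⟨C, hD⟩ := SemiPar.ae_domMeasure_mem_obsRange hV hZ hW hdata
  have hϑ : MemLp (SemiPar.theta β₀ h₀ H₀) ∞ (SemiPar.domMeasure G) :=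
    SemiPar.memLp_top_theta hD hh hH
  have hlaw := SemiPar.map_obs_eq_withDensity hF hU hV hZ hW hdata hh hH
  set M := SemiPar.transformationModel F G B₀ ν a b c₀ with hM
  have hP : M.law β₀ (h₀, H₀) = (SemiPar.domMeasure G).withDensity fun x =>
      ENNReal.ofReal (SemiPar.bernoulliDens F x.2.1 (SemiPar.theta β₀ h₀ H₀ x)) := rfl
  have hPlaw : μ.map (SemiPar.obs U V Z W) = M.law β₀ (h₀, H₀) := hlaw
  have : IsProbabilityMeasure (M.law β₀ (h₀, H₀)) := by
    rw [← hPlaw]; exact Measure.isProbabilityMeasure_map hobs.aemeasurable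
  have hac : M.law β₀ (h₀, H₀) ≪ SemiPar.domMeasure G := withDensity_absolutelyContinuous _ _
  have hDP : SemiPar.domMeasure G ≪ M.law β₀ (h₀, H₀) :=
    SemiPar.absolutelyContinuous_withDensity_bernoulliDens hF hD hϑ
  have hPr : ∀ᵐ x ∂M.law β₀ (h₀, H₀), x ∈ SemiPar.obsRange d a b l u C := hac.ae_le hD
  set Q := SemiPar.Qfun F f β₀ h₀ H₀ with hQdef
  set ℓ := SemiPar.ldot F f β₀ h₀ H₀ ht qt with hℓdef
  have hℓ : ∀ x i, ℓ x i = Q x * (x.2.2.1 i - ht x.2.2.2 i - qt x.1 i) :=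
    fun x i => by simp [hℓdef, SemiPar.ldot, hQdef]
  -- all functions involved are bounded in the range of the data
  have bddQ : ∀ P : Measure (SemiPar.Obs d), (∀ᵐ x ∂P, x ∈ SemiPar.obsRange d a b l u C) →
      MemLp Q ∞ P := fun P hP =>
    SemiPar.memLp_top_Qfun hF hP (SemiPar.memLp_top_theta hP hh hH)
  have bddht : ∀ i, ∀ P : Measure (SemiPar.Obs d), (∀ᵐ x ∂P, x ∈ SemiPar.obsRange d a b l u C) →
      MemLp (fun x : SemiPar.Obs d => ht x.2.2.2 i) ∞ P := fun i P hP =>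
    SemiPar.memLp_top_comp_continuousOn (h := fun w => ht w i)
      ((hlf.mem i).1.continuousOn hν hab) (by fun_prop) (hP.mono fun x hx => hx.2.2.2)
  have bddqt : ∀ i, ∀ P : Measure (SemiPar.Obs d), (∀ᵐ x ∂P, x ∈ SemiPar.obsRange d a b l u C) →
      MemLp (fun x : SemiPar.Obs d => qt x.1 i) ∞ P := fun i P hP =>
    SemiPar.memLp_top_comp_continuousOn (h := fun v => qt v i)
      ((EuclideanSpace.proj (𝕜 := ℝ) i).continuous.comp_continuousOn
        hlf.differentiable.continuousOn) (by fun_prop) (hP.mono fun x hx => hx.1)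
  have bddℓ : ∀ i, ∀ P : Measure (SemiPar.Obs d), (∀ᵐ x ∂P, x ∈ SemiPar.obsRange d a b l u C) →
      MemLp (fun x => ℓ x i) ∞ P := fun i P hP => by
    simp only [hℓ]
    exact SemiPar.memLp_top_mul (bddQ P hP)
      (((SemiPar.memLp_top_covariate hP i).sub (bddht i P hP)).sub (bddqt i P hP))
  have hscore : M.IsEfficientScore β₀ (h₀, H₀) ℓ := by
    have ms : ∀ i, MemLp (fun x : SemiPar.Obs d => x.2.2.1 i * Q x) 2 (M.law β₀ (h₀, H₀)) :=
      fun i => (SemiPar.memLp_top_mul (SemiPar.memLp_top_covariate hPr i)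
        (bddQ _ hPr)).mono_exponent le_top
    refine ⟨fun i => (ms i).toLp _, ?_, fun i => ?_⟩
    · exact SemiPar.tendsto_root_density_regression hF hD hϑ
        fun i => hDP.ae_le (ms i).coeFn_toLp
    obtain ⟨L, hL⟩ := hlf.bdd_deriv
    have hlip : ∀ v ∈ Icc l u, ∀ w ∈ Icc l u, |qt v i - qt w i| ≤ L * |v - w| :=
      fun v hv w hw => by
        have := (convex_Icc l u).norm_image_sub_le_of_norm_derivWithin_le hlf.differentiable
          hL hw hv
        exact (PiLp.norm_apply_le (qt v - qt w) i).trans this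
    obtain ⟨r₁, r₂, hr₁, hr₂, hr⟩ :=
      SemiPar.exists_monotone_sub_eq (q := fun v => qt v i) hdata.l_lt_u.le hlip
    -- Two paths are used: one in direction `(h̃, r₁)`, one in direction `(0, r₂)`. The difference
    -- of their scores is `(h̃ + q̃) Q` in component `i`; a direction `-r₂` need not keep `H`
    -- monotone, which is why the linear span is needed.
    have hzero : SemiPar.MemSobolevCentred ν a b (μ.map W) fun _ => 0 :=
      ⟨⟨fun _ _ => 0, fun _ _ => rfl, fun _ _ => ⟨integrableOn_zero, by simp⟩,
        MemLp.zero'⟩, by simp⟩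
    have m₁ : MemLp (fun x : SemiPar.Obs d => (ht x.2.2.2 i + r₁ x.1) * Q x) 2
        (M.law β₀ (h₀, H₀)) :=
      (SemiPar.memLp_top_mul ((bddht i _ hPr).add (SemiPar.memLp_top_comp_monotone hr₁
        (by fun_prop) (hPr.mono fun x hx => hx.1))) (bddQ _ hPr)).mono_exponent le_top
    have m₂ : MemLp (fun x : SemiPar.Obs d => ((0 : ℝ) + r₂ x.1) * Q x) 2
        (M.law β₀ (h₀, H₀)) :=
      (SemiPar.memLp_top_mul (MemLp.zero'.add (SemiPar.memLp_top_comp_monotone hr₂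
        (by fun_prop) (hPr.mono fun x hx => hx.1))) (bddQ _ hPr)).mono_exponent le_top
    have t₁ : m₁.toLp _ ∈ M.nuisanceTangentSet β₀ (h₀, H₀) :=
      SemiPar.mem_nuisanceTangentSet hF hν hab (hGW ▸ hPW) hD hβ₀ (hGW ▸ hh₀) hH
        (k := fun w => ht w i) (hGW ▸ hlf.mem i) hr₁ m₁.coeFn_toLp
    have t₂ : m₂.toLp _ ∈ M.nuisanceTangentSet β₀ (h₀, H₀) :=
      SemiPar.mem_nuisanceTangentSet hF hν hab (hGW ▸ hPW) hD hβ₀ (hGW ▸ hh₀) hH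
        (k := fun _ => 0) (hGW ▸ hzero) hr₂ m₂.coeFn_toLp
    have hres : (fun x => ℓ x i) =ᵐ[M.law β₀ (h₀, H₀)]
        ((ms i).toLp _ - (m₁.toLp _ - m₂.toLp _) : Lp ℝ 2 (M.law β₀ (h₀, H₀))) := by
      filter_upwards [Lp.coeFn_sub ((ms i).toLp _) (m₁.toLp _ - m₂.toLp _),
        Lp.coeFn_sub (m₁.toLp _) (m₂.toLp _), (ms i).coeFn_toLp, m₁.coeFn_toLp, m₂.coeFn_toLp,
        hPr] with x e1 e2 e3 e4 e5 hx
      rw [e1, Pi.sub_apply, e2, Pi.sub_apply, e3, e4, e5, hℓ, hr x.1 hx.1]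
      ring
    have hmem : m₁.toLp _ - m₂.toLp _ ∈ M.nuisanceTangentSpace β₀ (h₀, H₀) :=
      Submodule.le_topologicalClosure _
        (sub_mem (Submodule.subset_span t₁) (Submodule.subset_span t₂))
    obtain ⟨oW, oV⟩ := SemiPar.integral_ldot_mul_eq_zero hF hU hV hZ hW hν hab
      (hPlaw ▸ hPr) hh hH hlf i
    rw [hPlaw] at oW oV
    have horth : ∀ g ∈ M.nuisanceTangentSet β₀ (h₀, H₀),
        inner ℝ ((ms i).toLp _ - (m₁.toLp _ - m₂.toLp _)) g = 0 := by
      rintro g ⟨η, -, hpar, hdqm⟩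
      have hη : ∀ᶠ t in 𝓝[>] (0 : ℝ),
          SemiPar.MemSobolevCentredBdd ν a b (μ.map W) c₀ (η t).1 ∧ Monotone (η t).2 := by
        filter_upwards [nhdsWithin_mono 0 Ioi_subset_Ici_self hpar] with t ht
        exact ⟨hGW ▸ ht.2.1, ht.2.2⟩
      have key := SemiPar.integral_mul_nuisance_score_eq_zero hF hν hab hPW hD hh₀ hH hP
        (bddℓ i _ hD) oW oV hη (Lp.memLp g) hdqm
      rw [L2.inner_def]
      refine (integral_congr_ae ?_).trans key
      filter_upwards [hres] with x hx
      rw [← hx]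
      simp [mul_comm, hℓdef]
    have hproj : (M.nuisanceTangentSpace β₀ (h₀, H₀)).starProjection ((ms i).toLp _)
        = m₁.toLp _ - m₂.toLp _ := by
      refine Submodule.eq_starProjection_of_mem_of_inner_eq_zero hmem fun g hg => ?_
      -- Orthogonality passes from the tangent set to its closed span, since the orthogonal
      -- complement of the residual is a closed subspace.
      have hle : M.nuisanceTangentSpace β₀ (h₀, H₀)
          ≤ (Submodule.span ℝ {(ms i).toLp _ - (m₁.toLp _ - m₂.toLp _)})ᗮ :=
        Submodule.topologicalClosure_minimal _ (Submodule.span_le.2 fun g hg =>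
          Submodule.mem_orthogonal_singleton_iff_inner_right.2 (horth g hg))
          (Submodule.isClosed_orthogonal _)
      exact Submodule.mem_orthogonal_singleton_iff_inner_right.1 (hle hg)
    rw [hproj]
    exact hres
  refine ⟨⟨hβ₀, hGW ▸ hh₀, hH⟩, hPlaw, hscore, ℓ, hscore, fun i j => ?_⟩
  have hm := SemiPar.memLp_top_mul (bddℓ i _ hPr) (bddℓ j _ hPr)
  rw [← hPlaw] at hm ⊢
  exact (integral_map hobs.aemeasurable hm.1).symm
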